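/- Let $\Gamma=(G,\sigma)$ be a connected signed graph: $G$ is a finite simple graph on $n\ge 2$ vertices $1,\dots,n$ with edges $e_1,\dots,e_m$, and $\sigma:E(G)\to\{1,-1\}$. Let $N=[n_{ij}]$ be an incidence matrix of $\Gamma$: an $n\times m$ matrix with $n_{ij}=0$ if vertex $i$ is not an end of $e_j$, $n_{ij}\in\{1,-1\}$ if it is, and $n_{uj}n_{vj}=-\sigma(e_j)$ for $e_j=\{u,v\}$. The tail and head of a positive edge $e_j$ are its ends with entries $1$ and $-1$ in column $j$; the tail and head of a negative edge are its smaller and larger end. Put $w(e_j)=-1$ if $e_j$ is negative and both its entries in $N$ are $-1$, and $w(e_j)=1$ otherwise. The sign ${\rm sgn}(P)$ of a path $P$ is the product of the signs of its edges. $\Gamma$ is balanced if every cycle has an even number of negative edges, and unbalanced otherwise. $A^\dagger$ is the Moore-Penrose inverse of a real matrix $A$, i.e. the unique $X$ with $AXA=A$, $XAX=X$, $(AX)^{\intercal}=AX$, $(XA)^{\intercal}=XA$. For a spanning subgraph $H$, $N_H$ is the matrix of those columns of $N$ that belong to edges of $H$; columns of $N_H$, and rows of $N_H^\dagger$ and $N_H^{-1}$,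 keep the indices of the edges. For an edge $e$ of a forest or unicyclic component that is not on a cycle, $P_{e-j}$ is the shortest path that joins an end of $e$ to $j$ and does not contain $e$. (a) If $\Gamma$ is balanced, let $\mathcal S(\Gamma)$ be the set of its spanning trees and $\tau(\Gamma)=|\mathcal S(\Gamma)|$. Then for all $i,j$ $$(N^\dagger)_{ij}=\frac1{\tau(\Gamma)}\sum_{T\in\mathcal S(\Gamma),\ e_i\in T}(N_T^\dagger)_{ij},$$ and for every $T\in\mathcal S(\Gamma)$, $e_i\in T$ and vertex $j$ $$(N_T^\dagger)_{ij}=\frac{w(e_i)\,{\rm sgn}(P_{e_i-j})}{n}\begin{cases}|T_h(e_i)|&\text{if } j\in T_t(e_i),\\-\sigma(e_i)\,|T_t(e_i)|&\text{if } j\in T_h(e_i),\end{cases}$$ where $T_t(e_i)$ and $T_h(e_i)$ are the connected components of $T\setminus e_i$ containing the tail and the head of $e_i$, $|\cdot|$ counts vertices, and $P_{e_i-j}$ is taken in $T$. (b) If $\Gamma$ is unbalanced, let $\mathcal{TU}_n(\Gamma)$ be the set of spanning subgraphs $H$ of $\Gamma$ with exactly $n$ edges each of whose connected components is a tree or an unbalanced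 unicyclic graph (a connected graph with exactly one cycle, that cycle having an odd number of negative edges), and let $c(H)$ be the number of unbalanced unicyclic components of $H$. Then $NN^\dagger=I_n$ (for this reason $N^\dagger$ is also written $N^{-1}$), each $N_H$ with $H\in\mathcal{TU}_n(\Gamma)$ is square and invertible, and for all $i,j$ $$(N^\dagger)_{ij}=\frac{1}{\sum_{H\in\mathcal{TU}_n(\Gamma)}4^{c(H)}}\sum_{H\in\mathcal{TU}_n(\Gamma),\ e_i\in H}4^{c(H)}(N_H^{-1})_{ij}.$$ Moreover let $H\in\mathcal{TU}_n(\Gamma)$, $e_i\in H$, let $U$ be the (unicyclic) component of $H$ containing $e_i$, and $C$ its cycle. If $j\notin U$ then $(N_H^{-1})_{ij}=0$, and if $j\in U$ then $$(N_H^{-1})_{ij}=w(e_i)\begin{cases}\tfrac12\,{\rm sgn}(P_{e_i^t-j})&\text{if } e_i\in C,\\0&\text{if } e_i\notin C\text{ and } j\in U\setminus e_i[C],\\-{\rm sgn}(P_{e_i-j})&\text{if } e_i\notin C,\ \sigma(e_i)=1,\ j\notin U\setminus e_i[C]\text{ and } j\in U_h(e_i),\\{\rm sgn}(P_{e_i-j})&\text{otherwise,}\end{cases}$$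 where $P_{e_i^t-j}$ is the path from the tail of $e_i$ to $j$ in the tree $U\setminus e_i$, $U\setminus e_i[C]$ is the component of $U\setminus e_i$ containing $C$, and $U_h(e_i)$ is the component of $U\setminus e_i$ containing the head of $e_i$. -/

import Mathlib

/-- `X` is the Moore-Penrose inverse of the real matrix `A`. -/
def IsMoorePenroseInverse {ι κ : Type*} [Fintype ι] [Fintype κ]
    (A : Matrix ι κ ℝ) (X : Matrix κ ι ℝ) : Prop :=
  A * X * A = A ∧ X * A * X = X ∧ (A * X).transpose = A * X ∧ (X * A).transpose = X * A

/-- The Moore-Penrose inverse is unique, so one may speak of *the* Moore-Penrose inverse. -/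
theorem IsMoorePenroseInverse.unique {ι κ : Type*} [Fintype ι] [Fintype κ]
    {A : Matrix ι κ ℝ} {X Y : Matrix κ ι ℝ}
    (hX : IsMoorePenroseInverse A X) (hY : IsMoorePenroseInverse A Y) : X = Y := by
  obtain ⟨x1, x2, x3, x4⟩ := hX
  obtain ⟨y1, y2, y3, y4⟩ := hY
  have h1 : A * X = A * Y := by
    calc A * X = ((A * Y) * (A * X)).transpose := by
          rw [← Matrix.mul_assoc, y1, x3]
      _ = (A * X) * (A * Y) := by rw [Matrix.transpose_mul, x3, y3]
      _ = A * Y := by rw [← Matrix.mul_assoc, x1]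
  have h2 : X * A = Y * A := by
    calc X * A = ((X * A) * (Y * A)).transpose := by
          rw [Matrix.mul_assoc, ← Matrix.mul_assoc A, y1, x4]
      _ = (Y * A) * (X * A) := by rw [Matrix.transpose_mul, x4, y4]
      _ = Y * A := by rw [Matrix.mul_assoc, ← Matrix.mul_assoc A, x1]
  calc X = X * A * X := x2.symm
    _ = Y * A * Y := by rw [h2, Matrix.mul_assoc, h1, ← Matrix.mul_assoc]
    _ = Y := y2

/-- A (simple) signed graph on the vertices `0, …, n - 1`: a simple graph together with a
sign function on its edges. -/
structure SignedGraph (n : ℕ) where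
  /-- the underlying graph -/
  graph : SimpleGraph (Fin n)
  /-- the signature -/
  sign : graph.edgeSet → ℤˣ

namespace SignedGraph

variable {n : ℕ}

/-- The type of edges of a signed graph. -/
abbrev Edge (Γ : SignedGraph n) : Type := Γ.graph.edgeSet

noncomputable instance (Γ : SignedGraph n) : Fintype Γ.Edge := Fintype.ofFinite _

/-- Number of negative edges traversed by a walk. -/
def negCount (Γ : SignedGraph n) {u v : Fin n} (p : Γ.graph.Walk u v) : ℕ :=
  p.darts.countP fun d => Γ.sign ⟨d.edge, d.edge_mem⟩ = -1

/-- The product of the signs of the edges of a walk. -/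
def walkSign (Γ : SignedGraph n) {u v : Fin n} (p : Γ.graph.Walk u v) : ℤˣ :=
  (p.darts.map fun d => Γ.sign ⟨d.edge, d.edge_mem⟩).prod

/-- A signed graph is balanced if every cycle has an even number of negative edges. -/
def IsBalanced (Γ : SignedGraph n) : Prop :=
  ∀ (u : Fin n) (p : Γ.graph.Walk u u), p.IsCycle → Even (Γ.negCount p)

/-- `N` is an incidence matrix of `Γ`: rows are indexed by vertices, columns by edges; the entry
`N v e` is the sign of the end of `e` at `v`, and the two ends of an edge `e` have equal signs if
`e` is negative, opposite signs if `e` is positive. A positive edge is directed from its end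
with entry `1` to its end with entry `-1`. -/
def IsIncidenceMatrix (Γ : SignedGraph n) (N : Matrix (Fin n) Γ.Edge ℝ) : Prop :=
  (∀ (v : Fin n) (e : Γ.Edge), v ∉ e.1 → N v e = 0) ∧
  (∀ (v : Fin n) (e : Γ.Edge), v ∈ e.1 → N v e = 1 ∨ N v e = -1) ∧
  (∀ (u v : Fin n) (e : Γ.Edge), e.1 = s(u, v) → N u e * N v e = -((Γ.sign e : ℤ) : ℝ))

/-- The spanning subgraphs of `Γ`, i.e. those with the same vertices. -/
abbrev SpanningSubgraph (Γ : SignedGraph n) : Type :=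
  {H : SimpleGraph (Fin n) // H ≤ Γ.graph}

noncomputable instance (Γ : SignedGraph n) : Fintype Γ.SpanningSubgraph := Fintype.ofFinite _

/-- An edge of a spanning subgraph, as an edge of the whole graph. -/
def edgeIncl (Γ : SignedGraph n) (H : Γ.SpanningSubgraph) (e : H.1.edgeSet) : Γ.Edge :=
  ⟨e.1, SimpleGraph.edgeSet_mono H.2 e.2⟩

/-- A spanning subgraph, as a signed graph with the inherited signs. -/
def restrict (Γ : SignedGraph n) (H : Γ.SpanningSubgraph) : SignedGraph n where
  graph := H.1
  sign e := Γ.sign (Γ.edgeIncl H e)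

/-- The incidence matrix `N_H` of a spanning subgraph `H`: the columns of `N` belonging to the
edges of `H`. -/
def subIncidence (Γ : SignedGraph n) (N : Matrix (Fin n) Γ.Edge ℝ) (H : Γ.SpanningSubgraph) :
    Matrix (Fin n) (Γ.restrict H).Edge ℝ :=
  N.submatrix id (Γ.edgeIncl H)

/-- `Γ ∖ e`. -/
def delete (Γ : SignedGraph n) (e : Γ.Edge) : SignedGraph n :=
  Γ.restrict ⟨Γ.graph.deleteEdges {e.1}, SimpleGraph.deleteEdges_le _⟩

open Classical in
/-- The sign of a shortest path from `a` to `b` (`0` if there is no path). It is only used for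
`a`, `b` in a component that is a tree, where there is just one path. -/
noncomputable def pathSign (Γ : SignedGraph n) (a b : Fin n) : ℝ :=
  if h : Γ.graph.Reachable a b then
    ((Γ.walkSign h.exists_walk_length_eq_dist.choose : ℤ) : ℝ)
  else 0

open Classical in
/-- The tail of an edge: the smaller end of a negative edge, and for a positive edge the end from
which it is directed (matrix entry `1`). -/
noncomputable def tail (Γ : SignedGraph n) (N : Matrix (Fin n) Γ.Edge ℝ) (e : Γ.Edge) : Fin n :=
  if Γ.sign e = 1 ∧ N e.1.inf e = -1 then e.1.sup else e.1.inf

open Classical in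
/-- The head of an edge: the larger end of a negative edge, and for a positive edge the end to
which it is directed (matrix entry `-1`). -/
noncomputable def head (Γ : SignedGraph n) (N : Matrix (Fin n) Γ.Edge ℝ) (e : Γ.Edge) : Fin n :=
  if Γ.sign e = 1 ∧ N e.1.inf e = -1 then e.1.inf else e.1.sup

/-- The vertices of the connected component of `Γ ∖ e` that contains the tail of `e`. -/
def tailComponent (Γ : SignedGraph n) (N : Matrix (Fin n) Γ.Edge ℝ) (e : Γ.Edge) : Set (Fin n) :=
  {v | (Γ.delete e).graph.Reachable (Γ.tail N e) v}

/-- The vertices of the connected component of `Γ ∖ e` that contains the head of `e`. -/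
def headComponent (Γ : SignedGraph n) (N : Matrix (Fin n) Γ.Edge ℝ) (e : Γ.Edge) : Set (Fin n) :=
  {v | (Γ.delete e).graph.Reachable (Γ.head N e) v}

open Classical in
/-- `w(e) = -1` if `e` is a negative edge with both ends negative, and `w(e) = 1` otherwise. -/
noncomputable def weight (Γ : SignedGraph n) (N : Matrix (Fin n) Γ.Edge ℝ) (e : Γ.Edge) : ℝ :=
  if Γ.sign e = -1 ∧ ∀ v ∈ e.1, N v e = -1 then -1 else 1

open Classical in
/-- The sign of the path between the edge `e` and the vertex `j` that does not contain `e`. It is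
only used when `e` is a bridge; then `j` is joined in `Γ ∖ e` to at most one end of `e`. -/
noncomputable def edgePathSign (Γ : SignedGraph n) (N : Matrix (Fin n) Γ.Edge ℝ) (e : Γ.Edge)
    (j : Fin n) : ℝ :=
  if j ∈ Γ.tailComponent N e then (Γ.delete e).pathSign (Γ.tail N e) j
  else (Γ.delete e).pathSign (Γ.head N e) j

open Classical in
/-- The matrix given by the tree formula (meant for a signed tree `Γ` with incidence matrix
`N`). -/
noncomputable def treeInverse (Γ : SignedGraph n) (N : Matrix (Fin n) Γ.Edge ℝ) :
    Matrix Γ.Edge (Fin n) ℝ :=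
  Matrix.of fun e j =>
    Γ.weight N e * Γ.edgePathSign N e j / n *
      (if j ∈ Γ.tailComponent N e then ((Γ.headComponent N e).ncard : ℝ)
       else -((Γ.sign e : ℤ) : ℝ) * ((Γ.tailComponent N e).ncard : ℝ))

/-- The edge sets of the cycles contained in the connected component `c` of `Γ`. -/
def cyclesIn (Γ : SignedGraph n) (c : Γ.graph.ConnectedComponent) : Set (Set (Sym2 (Fin n))) :=
  {C | ∃ u ∈ c.supp, ∃ p : Γ.graph.Walk u u, p.IsCycle ∧ C = {e | e ∈ p.edges}}

/-- The component `c` is a tree: it contains no cycle. -/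
def IsTreeComponent (Γ : SignedGraph n) (c : Γ.graph.ConnectedComponent) : Prop :=
  Γ.cyclesIn c = ∅

/-- The component `c` is an unbalanced unicyclic graph: it contains exactly one cycle, and that
cycle has an odd number of negative edges. -/
def IsUnbalancedUnicyclicComponent (Γ : SignedGraph n) (c : Γ.graph.ConnectedComponent) : Prop :=
  (∃ C, Γ.cyclesIn c = {C}) ∧
    ∀ u ∈ c.supp, ∀ p : Γ.graph.Walk u u, p.IsCycle → ¬ Even (Γ.negCount p)

/-- Every component is a tree or an unbalanced unicyclic graph. -/
def IsTU (Γ : SignedGraph n) : Prop :=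
  ∀ c : Γ.graph.ConnectedComponent, Γ.IsTreeComponent c ∨ Γ.IsUnbalancedUnicyclicComponent c

/-- The number of components that are unbalanced unicyclic graphs. -/
noncomputable def numUnicyclic (Γ : SignedGraph n) : ℕ :=
  {c : Γ.graph.ConnectedComponent | Γ.IsUnbalancedUnicyclicComponent c}.ncard

/-- `e` lies on a cycle of `Γ`. -/
def OnCycle (Γ : SignedGraph n) (e : Γ.Edge) : Prop :=
  ∃ (u : Fin n) (p : Γ.graph.Walk u u), p.IsCycle ∧ e.1 ∈ p.edges

/-- The vertices that lie, after deletion of an edge `e` that is on no cycle, in a connected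
component containing a cycle. Within a unicyclic component `U` with cycle `C` that contains `e`,
this is `U ∖ e [C]`. -/
def cycleSide (Γ : SignedGraph n) (e : Γ.Edge) : Set (Fin n) :=
  {j | ∃ (u : Fin n) (p : Γ.graph.Walk u u), p.IsCycle ∧ (Γ.delete e).graph.Reachable u j}

open Classical in
/-- The matrix given by the unicyclic formula in each component (meant for a signed graph `Γ` all
of whose components are unbalanced unicyclic, with incidence matrix `N`); the entries at an edge
and a vertex of different components are zero. -/
noncomputable def unicyclicInverse (Γ : SignedGraph n) (N : Matrix (Fin n) Γ.Edge ℝ) :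
    Matrix Γ.Edge (Fin n) ℝ :=
  Matrix.of fun e j =>
    Γ.weight N e *
      (if ¬ Γ.graph.Reachable (Γ.tail N e) j then 0
       else if Γ.OnCycle e then 1 / 2 * (Γ.delete e).pathSign (Γ.tail N e) j
       else if j ∈ Γ.cycleSide e then 0
       else if Γ.sign e = 1 ∧ j ∈ Γ.headComponent N e then -Γ.edgePathSign N e j
       else Γ.edgePathSign N e j)

open Classical in
/-- The set of spanning trees of `Γ`. -/
noncomputable def spanningTrees (Γ : SignedGraph n) : Finset Γ.SpanningSubgraph :=
  Finset.univ.filter fun T => T.1.IsTree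

open Classical in
/-- The set of spanning `TU`-subgraphs of `Γ` with `n` edges, `n` the number of vertices. -/
noncomputable def spanningTU (Γ : SignedGraph n) : Finset Γ.SpanningSubgraph :=
  Finset.univ.filter fun H => (Γ.restrict H).IsTU ∧ H.1.edgeSet.ncard = n

open Classical in
/-- Extension by zero rows, for the edges outside `H`, of a matrix with rows indexed by the edges
of the spanning subgraph `H`. -/
noncomputable def extendZero (Γ : SignedGraph n) (H : Γ.SpanningSubgraph)
    (X : Matrix (Γ.restrict H).Edge (Fin n) ℝ) : Matrix Γ.Edge (Fin n) ℝ :=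
  Matrix.of fun e j => if h : e.1 ∈ H.1.edgeSet then X ⟨e.1, h⟩ j else 0

end SignedGraph

/-! A row vector z satisfies zN = 0 exactly when it is a potential: equal at the ends of a positive
edge, opposite at the ends of a negative one. If Γ is connected and unbalanced, only z = 0 is a
potential; if Γ is connected and balanced, the potentials are the multiples of one function s with
values ±1.

The heart is a fact about any matrix M of full row rank (`Matrix.isSymm_sum_smul_mul`). Let H run
over the column bases of M, and let D_H be the inverse of M_H padded with zero rows. The average X
of the D_H with weights det(M_H)² is the Moore-Penrose inverse of M. Since M D_H = 1 for each H,
also MX = 1, and only the symmetry of XM is in question. By Cramer's rule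
(`Matrix.det_mul_eq_det_update`), det(M_H)² (D_H M)_{ef} = det(M_H) det(M_{H-e+f}), so exchanging H
with H-e+f matches the terms at (e,f) with those at (f,e).

For unbalanced Γ take M = N. The bases are the TU-subgraphs with n edges, and having n edges forces
all their components to be unbalanced unicyclic. For balanced Γ let M be N with the extra column s.
The bases are the spanning trees together with that column, and since N_T times its Moore-Penrose
inverse is 1 - ssᵀ/n for every tree T, the result for M restricts to N.

The explicit inverses are checked row by row: row e is a potential of H∖e, hence orthogonal to every
other column, and is normalised against column e. The determinants follow from integrality alone
(`Matrix.det_sq_of_root`): det² is 4^{c(H)} for a TU-subgraph and n² for every tree, which is why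
the average over trees is unweighted. -/

open SimpleGraph

/-! ### Signs of walks, potentials, and deletion of an edge -/

namespace SignedGraph

variable {n : ℕ}

/-- The sign of an edge, as a real number. -/
def rsign (Γ : SignedGraph n) (e : Γ.Edge) : ℝ := ((Γ.sign e : ℤ) : ℝ)

/-- The sign of a walk, as a real number. -/
def rwalkSign (Γ : SignedGraph n) {u v : Fin n} (p : Γ.graph.Walk u v) : ℝ :=
  ((Γ.walkSign p : ℤ) : ℝ)

theorem cast_units_eq (x : ℤˣ) : ((x : ℤ) : ℝ) = 1 ∨ ((x : ℤ) : ℝ) = -1 := by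
  rcases Int.units_eq_one_or x with h | h <;> simp [h]

theorem rsign_eq (Γ : SignedGraph n) (e : Γ.Edge) : Γ.rsign e = 1 ∨ Γ.rsign e = -1 :=
  cast_units_eq _

theorem rwalkSign_eq (Γ : SignedGraph n) {u v : Fin n} (p : Γ.graph.Walk u v) :
    Γ.rwalkSign p = 1 ∨ Γ.rwalkSign p = -1 :=
  cast_units_eq _

theorem rsign_mul_self (Γ : SignedGraph n) (e : Γ.Edge) : Γ.rsign e * Γ.rsign e = 1 := by
  rcases Γ.rsign_eq e with h | h <;> simp [h]

theorem rsign_eq_one_iff (Γ : SignedGraph n) (e : Γ.Edge) : Γ.rsign e = 1 ↔ Γ.sign e = 1 := by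
  rcases Int.units_eq_one_or (Γ.sign e) with h | h <;> simp [rsign, h]; norm_num

theorem rsign_eq_neg_one_iff (Γ : SignedGraph n) (e : Γ.Edge) :
    Γ.rsign e = -1 ↔ Γ.sign e = -1 := by
  rcases Int.units_eq_one_or (Γ.sign e) with h | h <;> simp [rsign, h]; norm_num

@[simp]
theorem walkSign_nil (Γ : SignedGraph n) (u : Fin n) :
    Γ.walkSign (Walk.nil : Γ.graph.Walk u u) = 1 := by
  simp [walkSign]

@[simp]
theorem walkSign_cons (Γ : SignedGraph n) {u v w : Fin n} (h : Γ.graph.Adj u v)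
    (p : Γ.graph.Walk v w) :
    Γ.walkSign (Walk.cons h p) = Γ.sign ⟨s(u, v), h⟩ * Γ.walkSign p := by
  simp [walkSign, Dart.edge]

theorem walkSign_append (Γ : SignedGraph n) {u v w : Fin n} (p : Γ.graph.Walk u v)
    (q : Γ.graph.Walk v w) : Γ.walkSign (p.append q) = Γ.walkSign p * Γ.walkSign q := by
  simp [walkSign]

theorem walkSign_reverse (Γ : SignedGraph n) {u v : Fin n} (p : Γ.graph.Walk u v) :
    Γ.walkSign p.reverse = Γ.walkSign p := by
  simp [walkSign, Function.comp_def, List.map_reverse, List.prod_reverse]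

theorem walkSign_eq_neg_one_pow (Γ : SignedGraph n) {u v : Fin n} (p : Γ.graph.Walk u v) :
    Γ.walkSign p = (-1) ^ Γ.negCount p := by
  unfold walkSign negCount
  induction p.darts with
  | nil => simp
  | cons d l ih =>
    rw [List.map_cons, List.prod_cons, ih, List.countP_cons]
    rcases Int.units_eq_one_or (Γ.sign ⟨d.edge, d.edge_mem⟩) with h | h
    · simp [h]
    · simp [h, pow_succ]

theorem rwalkSign_of_even (Γ : SignedGraph n) {u v : Fin n} {p : Γ.graph.Walk u v}
    (h : Even (Γ.negCount p)) : Γ.rwalkSign p = 1 := by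
  simp [rwalkSign, walkSign_eq_neg_one_pow, h.neg_one_pow]

theorem rwalkSign_of_not_even (Γ : SignedGraph n) {u v : Fin n} {p : Γ.graph.Walk u v}
    (h : ¬ Even (Γ.negCount p)) : Γ.rwalkSign p = -1 := by
  simp [rwalkSign, walkSign_eq_neg_one_pow, (Nat.not_even_iff_odd.1 h).neg_one_pow]

/-- Every cycle in the component of `a` has an even number of negative edges. -/
def BalancedAt (Γ : SignedGraph n) (a : Fin n) : Prop :=
  ∀ u, Γ.graph.Reachable a u → ∀ p : Γ.graph.Walk u u, p.IsCycle → Even (Γ.negCount p)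

/-- Each closed piece cut out by `bypass` is either a cycle, which is even by balance, or one edge
traversed back and forth, whose sign is a square. -/
theorem walkSign_bypass {Γ : SignedGraph n} {a b : Fin n} (hb : Γ.BalancedAt b)
    (p : Γ.graph.Walk a b) : Γ.walkSign p.bypass = Γ.walkSign p := by
  induction p with
  | nil => rfl
  | @cons u v w h p ih =>
    have ih := ih hb
    simp only [Walk.bypass]
    split_ifs with hs
    · have key : Γ.walkSign (Walk.cons h (p.bypass.takeUntil u hs)) = 1 := by
        have hp : (p.bypass.takeUntil u hs).IsPath := p.bypass_isPath.takeUntil hs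
        generalize p.bypass.takeUntil u hs = q at hp
        by_cases hm : s(u, v) ∈ q.edges
        · have : q = Walk.cons h.symm Walk.nil := by
            cases q with
            | nil => simp at hm
            | @cons _ x _ h' q' =>
              rw [Walk.cons_isPath_iff] at hp
              rw [Walk.edges_cons, List.mem_cons] at hm
              rcases hm with hm | hm
              · have hx : x = u := by
                  rcases Sym2.eq_iff.1 hm with ⟨h1, _⟩ | ⟨h1, _⟩
                  · exact absurd h1 h.ne
                  · exact h1.symm
                subst hx
                have := (Walk.isPath_iff_nil.1 hp.1).eq_nil
                subst this
                rfl
              · exact absurd (Walk.snd_mem_support_of_mem_edges _ hm) hp.2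
          subst this
          rw [walkSign_cons, walkSign_cons, walkSign_nil, mul_one]
          have : (⟨s(v, u), h.symm⟩ : Γ.Edge) = ⟨s(u, v), h⟩ := Subtype.ext Sym2.eq_swap
          rw [this, Int.units_mul_self]
        · have hc : (Walk.cons h q).IsCycle := Walk.cons_isCycle_iff _ _ |>.2 ⟨hp, hm⟩
          rw [walkSign_eq_neg_one_pow]
          exact (hb u ((Walk.cons h p).reachable.symm) _ hc).neg_one_pow
      have e1 : Γ.walkSign (p.bypass.takeUntil u hs) * Γ.walkSign (p.bypass.dropUntil u hs)
          = Γ.walkSign p := by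
        rw [← walkSign_append, Walk.take_spec, ih]
      rw [walkSign_cons] at key
      rw [walkSign_cons, ← e1, ← mul_assoc, key, one_mul]
    · rw [walkSign_cons, walkSign_cons, ih]

/-- The closed walk along `p` and back along `q` bypasses to the trivial walk, so its sign is 1.
Hence the arbitrary choice of a shortest path in `pathSign` is immaterial in balanced components. -/
theorem walkSign_eq_of_balancedAt {Γ : SignedGraph n} {a b : Fin n} (ha : Γ.BalancedAt a)
    (p q : Γ.graph.Walk a b) : Γ.walkSign p = Γ.walkSign q := by
  have h := walkSign_bypass ha (p.append q.reverse)
  have h2 : (p.append q.reverse).bypass = Walk.nil := (Walk.isPath_iff_nil.1 (Walk.bypass_isPath _)).eq_nil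
  rw [h2, walkSign_nil, walkSign_append, walkSign_reverse] at h
  exact (mul_eq_one_iff_eq_inv.1 h.symm).trans (Int.units_inv_eq_self _)

theorem pathSign_eq_of_walk {Γ : SignedGraph n} {a b : Fin n} (ha : Γ.BalancedAt a)
    (p : Γ.graph.Walk a b) : Γ.pathSign a b = Γ.rwalkSign p := by
  rw [pathSign, dif_pos p.reachable, rwalkSign, walkSign_eq_of_balancedAt ha _ p]

theorem pathSign_of_not_reachable {Γ : SignedGraph n} {a b : Fin n}
    (h : ¬ Γ.graph.Reachable a b) : Γ.pathSign a b = 0 := by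
  rw [pathSign, dif_neg h]

theorem pathSign_of_reachable {Γ : SignedGraph n} {a b : Fin n}
    (h : Γ.graph.Reachable a b) : Γ.pathSign a b = 1 ∨ Γ.pathSign a b = -1 := by
  rw [pathSign, dif_pos h]; exact cast_units_eq _

/-- Real functions on the vertices that agree along positive edges and are opposite along
negative edges. -/
def IsPotential (Γ : SignedGraph n) (z : Fin n → ℝ) : Prop :=
  ∀ u v (h : Γ.graph.Adj u v), z u = Γ.rsign ⟨s(u, v), h⟩ * z v

theorem IsPotential.walk {Γ : SignedGraph n} {z : Fin n → ℝ} (hz : Γ.IsPotential z)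
    {a b : Fin n} (p : Γ.graph.Walk a b) : z a = Γ.rwalkSign p * z b := by
  induction p with
  | nil => simp [rwalkSign]
  | cons h p ih =>
    rw [hz _ _ h, ih, rwalkSign, rwalkSign, rsign, walkSign_cons]
    push_cast
    ring

theorem IsPotential.sq_eq {Γ : SignedGraph n} {z : Fin n → ℝ} (hz : Γ.IsPotential z)
    {a b : Fin n} (h : Γ.graph.Reachable a b) : z a = z b ∨ z a = - z b := by
  obtain ⟨p⟩ := h
  have := hz.walk p
  rcases Γ.rwalkSign_eq p with h | h <;> rw [h] at this <;> simp [this]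

theorem IsPotential.eq_pathSign {Γ : SignedGraph n} {z : Fin n → ℝ} (hz : Γ.IsPotential z)
    {a b : Fin n} (h : Γ.graph.Reachable a b) : z a = Γ.pathSign a b * z b := by
  rw [pathSign, dif_pos h]
  exact hz.walk _

theorem IsPotential.eq_zero_of_odd {Γ : SignedGraph n} {z : Fin n → ℝ} (hz : Γ.IsPotential z)
    {u a : Fin n} {p : Γ.graph.Walk u u} (hp : ¬ Even (Γ.negCount p))
    (ha : Γ.graph.Reachable u a) : z a = 0 := by
  have h := hz.walk p
  rw [Γ.rwalkSign_of_not_even hp] at h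
  rcases hz.sq_eq ha with h' | h' <;> linarith

theorem pathSign_self {Γ : SignedGraph n} {a : Fin n} (ha : Γ.BalancedAt a) :
    Γ.pathSign a a = 1 := by
  rw [pathSign_eq_of_walk ha Walk.nil]; simp [rwalkSign]

/-- The default value 0 at unreachable vertices makes this a potential of the whole graph, not only
of the component of `a`. -/
theorem isPotential_pathSign {Γ : SignedGraph n} {a : Fin n} (ha : Γ.BalancedAt a) :
    Γ.IsPotential (Γ.pathSign a) := by
  intro u v h
  by_cases hu : Γ.graph.Reachable a u
  · obtain ⟨p⟩ := hu
    have e : (⟨s(v, u), h.symm⟩ : Γ.Edge) = ⟨s(u, v), h⟩ := Subtype.ext Sym2.eq_swap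
    rw [pathSign_eq_of_walk ha p, pathSign_eq_of_walk ha (p.append (Walk.cons h Walk.nil)),
      rwalkSign, rwalkSign, walkSign_append, walkSign_cons, walkSign_nil, mul_one, rsign]
    push_cast
    rcases cast_units_eq (Γ.sign ⟨s(u, v), h⟩) with h | h <;> rw [h] <;> ring
  · rw [pathSign_of_not_reachable hu, pathSign_of_not_reachable, mul_zero]
    exact fun hv => hu (hv.trans h.symm.reachable)

/-- A function that satisfies the potential equation with the wrong sign at the edge `e`
changes its sign with each passage through `e`. -/
theorem walk_of_flip {Γ : SignedGraph n} (e : Γ.Edge) {z : Fin n → ℝ}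
    (h1 : ∀ u v (h : Γ.graph.Adj u v), s(u, v) ≠ e.1 → z u = Γ.rsign ⟨s(u, v), h⟩ * z v)
    (h2 : ∀ u v (h : Γ.graph.Adj u v), s(u, v) = e.1 → z u = -Γ.rsign ⟨s(u, v), h⟩ * z v)
    {a b : Fin n} (p : Γ.graph.Walk a b) :
    z a = Γ.rwalkSign p * (-1) ^ (p.edges.count e.1) * z b := by
  induction p with
  | nil => simp [rwalkSign]
  | @cons u v w h p ih =>
    rw [Walk.edges_cons]
    by_cases he : s(u, v) = e.1
    · have hc : (s(u, v) :: p.edges).count e.1 = p.edges.count e.1 + 1 := by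
        rw [he, List.count_cons_self]
      rw [h2 _ _ h he, ih, rwalkSign, rwalkSign, rsign, walkSign_cons, hc, pow_succ]
      push_cast
      ring
    · rw [h1 _ _ h he, ih, rwalkSign, rwalkSign, rsign, walkSign_cons, List.count_cons_of_ne he]
      push_cast
      ring

theorem isPotential_delete_iff {Γ : SignedGraph n} {e : Γ.Edge} {z : Fin n → ℝ} :
    (Γ.delete e).IsPotential z ↔
      ∀ u v (h : Γ.graph.Adj u v), s(u, v) ≠ e.1 → z u = Γ.rsign ⟨s(u, v), h⟩ * z v := by
  constructor
  · intro hz u v h he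
    exact hz u v (deleteEdges_adj.2 ⟨h, he⟩)
  · intro hz u v h
    exact hz u v (deleteEdges_adj.1 h).1 (deleteEdges_adj.1 h).2

theorem IsPotential.delete {Γ : SignedGraph n} {z : Fin n → ℝ} (hz : Γ.IsPotential z)
    (e : Γ.Edge) : (Γ.delete e).IsPotential z :=
  isPotential_delete_iff.2 fun u v h _ => hz u v h

theorem IsPotential.walk_of_delete {Γ : SignedGraph n} {e : Γ.Edge} {z : Fin n → ℝ}
    (hz : (Γ.delete e).IsPotential z) {a b : Fin n} (p : Γ.graph.Walk a b) (hp : e.1 ∉ p.edges) :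
    z a = Γ.rwalkSign p * z b := by
  induction p with
  | nil => simp [rwalkSign]
  | cons h p ih =>
    rw [Walk.edges_cons, List.mem_cons, not_or] at hp
    rw [isPotential_delete_iff.1 hz _ _ h (Ne.symm hp.1), ih hp.2, rwalkSign, rwalkSign, rsign,
      walkSign_cons]
    push_cast
    ring

theorem reachable_delete_of_walk {Γ : SignedGraph n} {e : Γ.Edge} {a b : Fin n}
    (p : Γ.graph.Walk a b) (hp : e.1 ∉ p.edges) : (Γ.delete e).graph.Reachable a b :=
  ⟨p.toDeleteEdges {e.1} fun f hf hf' => hp (by rw [Set.mem_singleton_iff] at hf'; rwa [hf'] at hf)⟩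

theorem Reachable.of_delete {Γ : SignedGraph n} {e : Γ.Edge} {a b : Fin n}
    (h : (Γ.delete e).graph.Reachable a b) : Γ.graph.Reachable a b :=
  h.mono (deleteEdges_le _)

theorem exists_isCycle_of_delete {Γ : SignedGraph n} {e : Γ.Edge} {u : Fin n}
    {p : (Γ.graph.deleteEdges {e.1}).Walk u u} (hp : p.IsCycle) :
    ∃ q : Γ.graph.Walk u u, q.IsCycle ∧ e.1 ∉ q.edges := by
  refine ⟨p.mapLe (deleteEdges_le _), (Walk.isCycle_mapLe _).2 hp, fun h => ?_⟩
  rw [Walk.edges_mapLe_eq_edges] at h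
  have := p.edges_subset_edgeSet h
  simp [edgeSet_deleteEdges] at this

/-- After its last passage through `e`, a walk starts from an end of `e` and no longer uses `e`. -/
theorem reachable_delete_or {Γ : SignedGraph n} {e : Γ.Edge} {t h a b : Fin n}
    (he : e.1 = s(t, h)) (hab : Γ.graph.Reachable a b) :
    (Γ.delete e).graph.Reachable a b ∨ (Γ.delete e).graph.Reachable t b ∨
      (Γ.delete e).graph.Reachable h b := by
  obtain ⟨p⟩ := hab
  induction p with
  | nil => exact Or.inl (Reachable.refl _)
  | @cons u v w huv p ih =>
    by_cases hm : s(u, v) = e.1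
    · rw [he] at hm
      rcases ih with ih | ih
      · rcases Sym2.eq_iff.1 hm with ⟨_, rfl⟩ | ⟨_, rfl⟩
        · exact Or.inr (Or.inr ih)
        · exact Or.inr (Or.inl ih)
      · exact Or.inr ih
    · rcases ih with ih | ih
      · have ha : (Γ.delete e).graph.Adj u v := deleteEdges_adj.2 ⟨huv, hm⟩
        exact Or.inl (ha.reachable.trans ih)
      · exact Or.inr ih

theorem onCycle_iff {Γ : SignedGraph n} {e : Γ.Edge} {t h : Fin n} (he : e.1 = s(t, h)) :
    Γ.OnCycle e ↔ (Γ.delete e).graph.Reachable t h := by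
  have hadj : Γ.graph.Adj t h := by
    have := e.2
    rwa [he] at this
  have := adj_and_reachable_delete_edges_iff_exists_cycle (G := Γ.graph) (v := t) (w := h)
  rw [and_iff_right hadj, ← he] at this
  exact this.symm

theorem OnCycle.reachable_delete {Γ : SignedGraph n} {e : Γ.Edge} (he : Γ.OnCycle e)
    {a b : Fin n} (hab : Γ.graph.Reachable a b) : (Γ.delete e).graph.Reachable a b := by
  obtain ⟨⟨t, h⟩, he2⟩ := e
  have hth := (onCycle_iff (t := t) (h := h) rfl).1 he
  rcases reachable_delete_or (e := ⟨s(t, h), he2⟩) (t := t) (h := h) rfl hab with h1 | h1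
  · exact h1
  rcases reachable_delete_or (e := ⟨s(t, h), he2⟩) (t := t) (h := h) rfl hab.symm with h2 | h2
  · exact h2.symm
  have h1' : (Γ.delete ⟨s(t, h), he2⟩).graph.Reachable t b := h1.elim id hth.trans
  have h2' : (Γ.delete ⟨s(t, h), he2⟩).graph.Reachable t a := h2.elim id hth.trans
  exact h2'.symm.trans h1'

end SignedGraph

/-! ### Columns of the incidence matrix -/

namespace SignedGraph

variable {n : ℕ}

section Incidence

variable (Γ : SignedGraph n) (N : Matrix (Fin n) Γ.Edge ℝ)

theorem edge_eq_tail_head (e : Γ.Edge) : e.1 = s(Γ.tail N e, Γ.head N e) := by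
  have h : e.1 = s(e.1.inf, e.1.sup) := by
    induction e.1 using Sym2.ind with
    | _ a b =>
      rcases le_total a b with h | h
      · simp [h]
      · simp [h, Sym2.eq_swap]
  unfold tail head
  split_ifs
  · rw [Sym2.eq_swap]; exact h
  · exact h

theorem adj_tail_head (e : Γ.Edge) : Γ.graph.Adj (Γ.tail N e) (Γ.head N e) := by
  have h := e.2
  rw [Γ.edge_eq_tail_head N e] at h
  exact h

theorem tail_ne_head (e : Γ.Edge) : Γ.tail N e ≠ Γ.head N e :=
  (Γ.adj_tail_head N e).ne

theorem tail_mem (e : Γ.Edge) : Γ.tail N e ∈ e.1 := by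
  have h := Γ.edge_eq_tail_head N e
  generalize Γ.tail N e = t at *
  rw [h]; exact Sym2.mem_mk_left _ _

theorem isPotential_iff_tail_head {z : Fin n → ℝ} :
    Γ.IsPotential z ↔ ∀ e : Γ.Edge, z (Γ.tail N e) = Γ.rsign e * z (Γ.head N e) := by
  constructor
  · intro hz e
    have h := hz _ _ (Γ.adj_tail_head N e)
    have he : (⟨s(Γ.tail N e, Γ.head N e), Γ.adj_tail_head N e⟩ : Γ.Edge) = e :=
      Subtype.ext (Γ.edge_eq_tail_head N e).symm
    rwa [he] at h
  · intro hz u v h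
    have h1 := hz ⟨s(u, v), h⟩
    have h2 := Γ.edge_eq_tail_head N ⟨s(u, v), h⟩
    rcases Sym2.eq_iff.1 h2 with ⟨h3, h4⟩ | ⟨h3, h4⟩
    · rwa [← h3, ← h4] at h1
    · rw [← h3, ← h4] at h1
      rw [h1, ← mul_assoc, rsign_mul_self, one_mul]

theorem isPotential_delete_iff_tail_head {e : Γ.Edge} {z : Fin n → ℝ} :
    (Γ.delete e).IsPotential z ↔
      ∀ f : Γ.Edge, f ≠ e → z (Γ.tail N f) = Γ.rsign f * z (Γ.head N f) := by
  rw [isPotential_delete_iff]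
  constructor
  · intro hz f hf
    have h := hz _ _ (Γ.adj_tail_head N f)
    have he : (⟨s(Γ.tail N f, Γ.head N f), Γ.adj_tail_head N f⟩ : Γ.Edge) = f :=
      Subtype.ext (Γ.edge_eq_tail_head N f).symm
    rw [he, ← Γ.edge_eq_tail_head N f] at h
    exact h fun h => hf (Subtype.ext h)
  · intro hz u v h hne
    have h1 := hz ⟨s(u, v), h⟩ fun h => hne (congrArg Subtype.val h)
    have h2 := Γ.edge_eq_tail_head N ⟨s(u, v), h⟩
    rcases Sym2.eq_iff.1 h2 with ⟨h3, h4⟩ | ⟨h3, h4⟩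
    · rwa [← h3, ← h4] at h1
    · rw [← h3, ← h4] at h1
      rw [h1, ← mul_assoc, rsign_mul_self, one_mul]

variable {Γ N}

theorem IsPotential.of_delete {e : Γ.Edge} {z : Fin n → ℝ} (hz : (Γ.delete e).IsPotential z)
    (he : z (Γ.tail N e) = Γ.rsign e * z (Γ.head N e)) : Γ.IsPotential z := by
  rw [Γ.isPotential_iff_tail_head N]
  intro f
  by_cases hf : f = e
  · rw [hf]; exact he
  · exact (Γ.isPotential_delete_iff_tail_head N).1 hz f hf

theorem IsIncidenceMatrix.apply_eq (hN : Γ.IsIncidenceMatrix N) (v : Fin n) (e : Γ.Edge) :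
    N v e = 0 ∨ N v e = 1 ∨ N v e = -1 := by
  by_cases h : v ∈ e.1
  · exact Or.inr (hN.2.1 v e h)
  · exact Or.inl (hN.1 v e h)

theorem IsIncidenceMatrix.head_eq (hN : Γ.IsIncidenceMatrix N) (e : Γ.Edge) :
    N (Γ.head N e) e = -Γ.rsign e * N (Γ.tail N e) e := by
  have h : _ = -Γ.rsign e := hN.2.2 _ _ e (Γ.edge_eq_tail_head N e)
  rw [← h]
  rcases hN.2.1 _ e (Γ.tail_mem N e) with h | h <;> rw [h] <;> ring

/-- The tail of a positive edge is chosen to carry the entry 1, and a negative edge has the same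
entry at both ends; so w(e) is the common factor of column `e`. -/
theorem IsIncidenceMatrix.weight_eq (hN : Γ.IsIncidenceMatrix N) (e : Γ.Edge) :
    Γ.weight N e = N (Γ.tail N e) e := by
  have hh := hN.head_eq e
  have ht := hN.2.1 _ e (Γ.tail_mem N e)
  unfold weight
  rcases Int.units_eq_one_or (Γ.sign e) with hs | hs
  · rw [if_neg (by rw [hs]; simp)]
    have hi : e.1.inf ∈ e.1 := by
      have h := Γ.edge_eq_tail_head N e
      unfold tail head at h
      by_cases hc : Γ.sign e = 1 ∧ N e.1.inf e = -1
      · simp only [if_pos hc] at h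
        have h' : ∀ x ∈ s(e.1.sup, e.1.inf), x ∈ e.1 := fun x hx => by rw [h]; exact hx
        exact h' _ (Sym2.mem_mk_right _ _)
      · simp only [if_neg hc] at h
        have h' : ∀ x ∈ s(e.1.inf, e.1.sup), x ∈ e.1 := fun x hx => by rw [h]; exact hx
        exact h' _ (Sym2.mem_mk_left _ _)
    rw [(Γ.rsign_eq_one_iff e).2 hs] at hh
    by_cases hc : N e.1.inf e = -1
    · have h1 : Γ.head N e = e.1.inf := by rw [head, if_pos ⟨hs, hc⟩]
      rw [h1, hc] at hh
      linarith
    · have h1 : Γ.tail N e = e.1.inf := by rw [tail, if_neg (fun h => hc h.2)]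
      rw [h1]
      rcases hN.2.1 _ e hi with h | h
      · exact h.symm
      · exact absurd h hc
  · rw [(Γ.rsign_eq_neg_one_iff e).2 hs, neg_neg, one_mul] at hh
    rcases ht with h | h
    · rw [if_neg, h]
      rintro ⟨_, h'⟩
      have := h' _ (Γ.tail_mem N e)
      rw [h] at this
      norm_num at this
    · rw [if_pos, h]
      refine ⟨hs, fun v hv => ?_⟩
      have hv' : v ∈ s(Γ.tail N e, Γ.head N e) := (Γ.edge_eq_tail_head N e) ▸ hv
      rcases Sym2.mem_iff.1 hv' with rfl | rfl
      · exact h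
      · rw [hh, h]

theorem IsIncidenceMatrix.weight_mul_self (hN : Γ.IsIncidenceMatrix N) (e : Γ.Edge) :
    Γ.weight N e * Γ.weight N e = 1 := by
  rw [hN.weight_eq]
  rcases hN.2.1 _ e (Γ.tail_mem N e) with h | h <;> rw [h] <;> norm_num

/-- Column `e` is w(e) at the tail and -σ(e)w(e) at the head. Pairing with it measures the failure
of the potential equation at `e`, so the left kernel of `N` is the space of potentials. -/
theorem IsIncidenceMatrix.sum_mul (hN : Γ.IsIncidenceMatrix N) (z : Fin n → ℝ) (e : Γ.Edge) :
    ∑ v, z v * N v e =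
      Γ.weight N e * (z (Γ.tail N e) - Γ.rsign e * z (Γ.head N e)) := by
  rw [Fintype.sum_eq_add _ _ (Γ.tail_ne_head N e), hN.head_eq, hN.weight_eq]
  · ring
  · rintro x ⟨h1, h2⟩
    rw [hN.1 x e, mul_zero]
    intro hx
    have hv' : x ∈ s(Γ.tail N e, Γ.head N e) := (Γ.edge_eq_tail_head N e) ▸ hx
    rcases Sym2.mem_iff.1 hv' with h | h
    · exact h1 h
    · exact h2 h

theorem IsIncidenceMatrix.sum_mul_eq_zero_iff (hN : Γ.IsIncidenceMatrix N) (z : Fin n → ℝ)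
    (e : Γ.Edge) :
    ∑ v, z v * N v e = 0 ↔ z (Γ.tail N e) = Γ.rsign e * z (Γ.head N e) := by
  have hw : Γ.weight N e ≠ 0 := fun h => by
    have := hN.weight_mul_self e
    simp [h] at this
  rw [hN.sum_mul, mul_eq_zero, or_iff_right hw, sub_eq_zero]

theorem IsIncidenceMatrix.isPotential_iff (hN : Γ.IsIncidenceMatrix N) {z : Fin n → ℝ} :
    Γ.IsPotential z ↔ ∀ e, ∑ v, z v * N v e = 0 := by
  rw [Γ.isPotential_iff_tail_head N]
  exact forall_congr' fun e => (hN.sum_mul_eq_zero_iff z e).symm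

theorem IsIncidenceMatrix.restrict (hN : Γ.IsIncidenceMatrix N) (H : Γ.SpanningSubgraph) :
    (Γ.restrict H).IsIncidenceMatrix (Γ.subIncidence N H) :=
  ⟨fun v e hv => hN.1 v (Γ.edgeIncl H e) hv, fun v e hv => hN.2.1 v (Γ.edgeIncl H e) hv,
    fun u v e he => hN.2.2 u v (Γ.edgeIncl H e) he⟩

end Incidence

end SignedGraph

/-! ### Rows of the unicyclic formula paired with the columns of N -/

namespace SignedGraph

variable {n : ℕ} {Γ : SignedGraph n} {N : Matrix (Fin n) Γ.Edge ℝ}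

theorem IsPotential.smul {z : Fin n → ℝ} (hz : Γ.IsPotential z) (c : ℝ) :
    Γ.IsPotential fun j => c * z j := fun u v h => by
  show c * z u = _ * (c * z v)
  rw [hz u v h]; ring

theorem IsPotential.sub {y z : Fin n → ℝ} (hy : Γ.IsPotential y) (hz : Γ.IsPotential z) :
    Γ.IsPotential fun j => y j - z j := fun u v h => by
  show y u - z u = _ * (y v - z v)
  rw [hy u v h, hz u v h]; ring

theorem not_reachable_delete {e : Γ.Edge} (he : ¬ Γ.OnCycle e) :
    ¬ (Γ.delete e).graph.Reachable (Γ.tail N e) (Γ.head N e) :=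
  fun h => he ((onCycle_iff (Γ.edge_eq_tail_head N e)).2 h)

theorem not_mem_headComponent {e : Γ.Edge} (he : ¬ Γ.OnCycle e) {j : Fin n}
    (hj : j ∈ Γ.tailComponent N e) : j ∉ Γ.headComponent N e :=
  fun hj' => not_reachable_delete he (Reachable.trans hj (Reachable.symm hj'))

theorem IsTU.unicyclic_of_isCycle (h : Γ.IsTU) {u : Fin n} {p : Γ.graph.Walk u u}
    (hp : p.IsCycle) : Γ.IsUnbalancedUnicyclicComponent (Γ.graph.connectedComponentMk u) := by
  rcases h (Γ.graph.connectedComponentMk u) with h | h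
  · have : {e | e ∈ p.edges} ∈ Γ.cyclesIn (Γ.graph.connectedComponentMk u) :=
      ⟨u, rfl, p, hp, rfl⟩
    rw [h] at this
    exact this.elim
  · exact h

theorem IsTU.odd (h : Γ.IsTU) {u : Fin n} {p : Γ.graph.Walk u u} (hp : p.IsCycle) :
    ¬ Even (Γ.negCount p) :=
  (h.unicyclic_of_isCycle hp).2 u rfl p hp

theorem IsTU.mem_edges (h : Γ.IsTU) {u v : Fin n} (huv : Γ.graph.Reachable u v)
    {p : Γ.graph.Walk u u} {q : Γ.graph.Walk v v} (hp : p.IsCycle) (hq : q.IsCycle)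
    {f : Sym2 (Fin n)} (hf : f ∈ p.edges) : f ∈ q.edges := by
  obtain ⟨⟨C, hC⟩, _⟩ := h.unicyclic_of_isCycle hp
  have h1 : {e | e ∈ p.edges} ∈ Γ.cyclesIn (Γ.graph.connectedComponentMk u) :=
    ⟨u, rfl, p, hp, rfl⟩
  have h2 : {e | e ∈ q.edges} ∈ Γ.cyclesIn (Γ.graph.connectedComponentMk u) :=
    ⟨v, (ConnectedComponent.eq.2 huv).symm, q, hq, rfl⟩
  rw [hC, Set.mem_singleton_iff] at h1 h2
  rw [← h2] at h1
  exact (Set.ext_iff.1 h1 f).1 hf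

theorem balancedAt_of_not_mem_cycleSide {e : Γ.Edge} {a : Fin n} (ha : a ∉ Γ.cycleSide e) :
    (Γ.delete e).BalancedAt a := by
  intro u hu p hp
  obtain ⟨q, hq, _⟩ := exists_isCycle_of_delete (p := p) hp
  exact (ha ⟨u, q, hq, hu.symm⟩).elim

/-- A cycle surviving the deletion would avoid `e`, while the only cycle of the component passes
through `e`; the balance is vacuous. -/
theorem IsTU.balancedAt_delete (h : Γ.IsTU) {e : Γ.Edge} (he : Γ.OnCycle e) :
    (Γ.delete e).BalancedAt (Γ.tail N e) := by
  intro u hu p hp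
  obtain ⟨q, hq, hqe⟩ := exists_isCycle_of_delete (p := p) hp
  obtain ⟨v, r, hr, hre⟩ := he
  refine (hqe (h.mem_edges ?_ hr hq hre)).elim
  have h1 : Γ.tail N e ∈ r.support := by
    rw [Γ.edge_eq_tail_head N e] at hre
    exact Walk.fst_mem_support_of_mem_edges _ hre
  exact (r.takeUntil _ h1).reachable.trans (Reachable.of_delete hu)

theorem unicyclicInverse_of_onCycle {e : Γ.Edge} (he : Γ.OnCycle e) (j : Fin n) :
    Γ.unicyclicInverse N e j =
      (Γ.weight N e / 2) * (Γ.delete e).pathSign (Γ.tail N e) j := by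
  rw [unicyclicInverse, Matrix.of_apply]
  by_cases hj : Γ.graph.Reachable (Γ.tail N e) j
  · rw [if_neg (not_not.2 hj), if_pos he]; ring
  · rw [if_pos hj, pathSign_of_not_reachable fun h => hj (Reachable.of_delete h)]; simp

theorem mem_cycleSide_of_reachable {e : Γ.Edge} {a j : Fin n} (ha : a ∈ Γ.cycleSide e)
    (haj : (Γ.delete e).graph.Reachable a j) : j ∈ Γ.cycleSide e := by
  obtain ⟨u, p, hp, h⟩ := ha
  exact ⟨u, p, hp, h.trans haj⟩

open Classical in
/-- The path signs from `a` in `Γ ∖ e`, cut down to the part outside the cycles. -/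
noncomputable def branchSign (Γ : SignedGraph n) (e : Γ.Edge) (a j : Fin n) : ℝ :=
  if a ∈ Γ.cycleSide e then 0 else (Γ.delete e).pathSign a j

theorem isPotential_branchSign (e : Γ.Edge) (a : Fin n) :
    (Γ.delete e).IsPotential (Γ.branchSign e a) := by
  by_cases h : a ∈ Γ.cycleSide e
  · intro u v huv; simp [branchSign, h]
  · have h1 := isPotential_pathSign (balancedAt_of_not_mem_cycleSide h)
    intro u v huv
    simpa [branchSign, h] using h1 u v huv

/-- The path signs from an end of a bridge vanish beyond the bridge, so the case distinction
collapses to a difference of two functions, one for each side. In this form the row is visibly a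
potential of Γ∖e. -/
theorem unicyclicInverse_of_not_onCycle {e : Γ.Edge} (he : ¬ Γ.OnCycle e) (j : Fin n) :
    Γ.unicyclicInverse N e j = Γ.weight N e *
      (Γ.branchSign e (Γ.tail N e) j - Γ.rsign e * Γ.branchSign e (Γ.head N e) j) := by
  rw [unicyclicInverse, Matrix.of_apply, branchSign, branchSign]
  congr 1
  by_cases hj : Γ.graph.Reachable (Γ.tail N e) j
  · rw [if_neg (not_not.2 hj), if_neg he]
    by_cases ht : j ∈ Γ.tailComponent N e
    · have hh := not_mem_headComponent he ht
      have h0 : (Γ.delete e).pathSign (Γ.head N e) j = 0 := pathSign_of_not_reachable hh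
      have hc : j ∈ Γ.cycleSide e ↔ Γ.tail N e ∈ Γ.cycleSide e :=
        ⟨fun h => mem_cycleSide_of_reachable h (Reachable.symm ht),
          fun h => mem_cycleSide_of_reachable h ht⟩
      by_cases hcs : Γ.tail N e ∈ Γ.cycleSide e
      · simp [h0, hcs, hc.2 hcs]
      · simp [edgePathSign, ht, hh, h0, hcs, mt hc.1 hcs]
    · have hh : j ∈ Γ.headComponent N e := by
        rcases reachable_delete_or (Γ.edge_eq_tail_head N e) hj with h | h | h
        · exact absurd h ht
        · exact absurd h ht
        · exact h
      have h0 : (Γ.delete e).pathSign (Γ.tail N e) j = 0 := pathSign_of_not_reachable ht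
      have hc : j ∈ Γ.cycleSide e ↔ Γ.head N e ∈ Γ.cycleSide e :=
        ⟨fun h => mem_cycleSide_of_reachable h (Reachable.symm hh),
          fun h => mem_cycleSide_of_reachable h hh⟩
      by_cases hcs : Γ.head N e ∈ Γ.cycleSide e
      · simp [h0, hcs, hc.2 hcs]
      · have hjs := mt hc.1 hcs
        rcases Γ.rsign_eq e with hs | hs
        · simp [edgePathSign, ht, hh, h0, hcs, hjs, hs, (Γ.rsign_eq_one_iff e).1 hs]
        · have hs' := (Γ.rsign_eq_neg_one_iff e).1 hs
          simp [edgePathSign, ht, h0, hcs, hjs, hs, hs']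
  · rw [if_pos hj, pathSign_of_not_reachable fun h => hj (Reachable.of_delete h),
      pathSign_of_not_reachable fun h =>
        hj ((Γ.adj_tail_head N e).reachable.trans (Reachable.of_delete h))]
    simp

theorem IsTU.isPotential_unicyclicInverse (h : Γ.IsTU) (e : Γ.Edge) :
    (Γ.delete e).IsPotential (Γ.unicyclicInverse N e) := by
  by_cases he : Γ.OnCycle e
  · have := (isPotential_pathSign (h.balancedAt_delete (N := N) he)).smul (Γ.weight N e / 2)
    rwa [← funext (unicyclicInverse_of_onCycle he)] at this
  · have := ((isPotential_branchSign e (Γ.tail N e)).sub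
      ((isPotential_branchSign e (Γ.head N e)).smul (Γ.rsign e))).smul (Γ.weight N e)
    rwa [← funext (unicyclicInverse_of_not_onCycle he)] at this

theorem IsTU.sum_unicyclicInverse_mul_of_ne (h : Γ.IsTU) (hN : Γ.IsIncidenceMatrix N)
    {e f : Γ.Edge} (hf : f ≠ e) : ∑ v, Γ.unicyclicInverse N e v * N v f = 0 :=
  (hN.sum_mul_eq_zero_iff _ f).2
    ((Γ.isPotential_delete_iff_tail_head N).1 (h.isPotential_unicyclicInverse e) f hf)

/-- If the path from tail to head in Γ∖e had sign σ(e), the path signs from the tail would be a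
potential of Γ with value 1 at the tail, which the odd cycle forbids. So the sign is -σ(e), and each
end of `e` contributes 1/2. -/
theorem IsTU.sum_unicyclicInverse_mul_of_onCycle (h : Γ.IsTU) (hN : Γ.IsIncidenceMatrix N)
    {e : Γ.Edge} (he : Γ.OnCycle e) : ∑ v, Γ.unicyclicInverse N e v * N v e = 1 := by
  rw [hN.sum_mul, unicyclicInverse_of_onCycle he, unicyclicInverse_of_onCycle he]
  have hb := h.balancedAt_delete (N := N) he
  have hr := (onCycle_iff (Γ.edge_eq_tail_head N e)).1 he
  have h1 : (Γ.delete e).pathSign (Γ.tail N e) (Γ.head N e) = -Γ.rsign e := by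
    by_contra hne
    have h2 : (Γ.delete e).pathSign (Γ.tail N e) (Γ.head N e) = Γ.rsign e := by
      rcases Γ.rsign_eq e with h3 | h3 <;> rcases pathSign_of_reachable hr with h4 | h4 <;>
        rw [h3, h4] at hne <;> rw [h3, h4] <;> norm_num at hne
    have hp : Γ.IsPotential ((Γ.delete e).pathSign (Γ.tail N e)) := by
      refine IsPotential.of_delete (N := N) (isPotential_pathSign hb) ?_
      rw [pathSign_self hb, h2, rsign_mul_self]
    obtain ⟨v, r, hcyc, hre⟩ := he
    have hm : Γ.tail N e ∈ r.support := by
      rw [Γ.edge_eq_tail_head N e] at hre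
      exact Walk.fst_mem_support_of_mem_edges _ hre
    have h5 := hp.eq_zero_of_odd (h.odd hcyc) (r.takeUntil _ hm).reachable
    rw [pathSign_self hb] at h5
    exact one_ne_zero h5
  rw [pathSign_self hb, h1]
  have h6 := hN.weight_mul_self e
  have h7 := Γ.rsign_mul_self e
  linear_combination (1 / 2 + Γ.rsign e * Γ.rsign e / 2) * h6 + (1 / 2) * h7

-- The pairing counts the sides of the bridge without a cycle: one in a unicyclic component, two in
-- a tree. Tree components cannot be excluded before the edges are counted, so the value 2 has to be
-- allowed for.
open Classical in
theorem sum_unicyclicInverse_mul_of_not_onCycle (hN : Γ.IsIncidenceMatrix N)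
    {e : Γ.Edge} (he : ¬ Γ.OnCycle e) : ∑ v, Γ.unicyclicInverse N e v * N v e =
      (if Γ.tail N e ∈ Γ.cycleSide e then 0 else 1) +
        (if Γ.head N e ∈ Γ.cycleSide e then 0 else 1) := by
  have hr : ¬ (Γ.delete e).graph.Reachable (Γ.tail N e) (Γ.head N e) := not_reachable_delete he
  have h1 : (Γ.delete e).pathSign (Γ.tail N e) (Γ.head N e) = 0 := pathSign_of_not_reachable hr
  have h2 : (Γ.delete e).pathSign (Γ.head N e) (Γ.tail N e) = 0 :=
    pathSign_of_not_reachable fun h => hr h.symm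
  rw [hN.sum_mul, unicyclicInverse_of_not_onCycle he, unicyclicInverse_of_not_onCycle he]
  simp only [branchSign, h1, h2, ite_self]
  have h3 : (if Γ.tail N e ∈ Γ.cycleSide e then 0
      else (Γ.delete e).pathSign (Γ.tail N e) (Γ.tail N e)) =
      if Γ.tail N e ∈ Γ.cycleSide e then 0 else 1 := by
    split_ifs with h
    · rfl
    · exact pathSign_self (balancedAt_of_not_mem_cycleSide h)
  have h4 : (if Γ.head N e ∈ Γ.cycleSide e then 0
      else (Γ.delete e).pathSign (Γ.head N e) (Γ.head N e)) =
      if Γ.head N e ∈ Γ.cycleSide e then 0 else 1 := by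
    split_ifs with h
    · rfl
    · exact pathSign_self (balancedAt_of_not_mem_cycleSide h)
  rw [h3, h4]
  generalize (if Γ.tail N e ∈ Γ.cycleSide e then (0 : ℝ) else 1) = x
  generalize (if Γ.head N e ∈ Γ.cycleSide e then (0 : ℝ) else 1) = y
  have h6 := hN.weight_mul_self e
  have h7 := Γ.rsign_mul_self e
  linear_combination (x + Γ.rsign e * Γ.rsign e * y) * h6 + y * h7

theorem reachable_delete_of_mem_support {e : Γ.Edge} {u x : Fin n} {p : Γ.graph.Walk u u}
    (hp : e.1 ∉ p.edges) (hx : x ∈ p.support) : (Γ.delete e).graph.Reachable u x :=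
  reachable_delete_of_walk (p.takeUntil x hx)
    fun h => hp (p.edges_takeUntil_subset_edges hx h)

/-- Cycles on both sides would lie in one component, hence have the same edges, and a common edge
would connect the two sides without `e`. -/
theorem IsTU.not_mem_cycleSide (h : Γ.IsTU) {e : Γ.Edge} (he : ¬ Γ.OnCycle e)
    (ht : Γ.tail N e ∈ Γ.cycleSide e) : Γ.head N e ∉ Γ.cycleSide e := by
  rintro ⟨v, q, hq, hqh⟩
  obtain ⟨u, p, hp, hpt⟩ := ht
  have hpe : e.1 ∉ p.edges := fun h => he ⟨u, p, hp, h⟩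
  have hqe : e.1 ∉ q.edges := fun h => he ⟨v, q, hq, h⟩
  have huv : Γ.graph.Reachable u v := (Reachable.of_delete hpt).trans
    ((Γ.adj_tail_head N e).reachable.trans (Reachable.of_delete hqh).symm)
  cases hpc : p with
  | nil => subst hpc; exact hp.ne_nil rfl
  | @cons _ w _ hw p' =>
    have hm : s(u, w) ∈ p.edges := by rw [hpc]; simp
    have hm' := h.mem_edges huv hp hq hm
    have h1 := reachable_delete_of_mem_support hqe (Walk.fst_mem_support_of_mem_edges _ hm')
    exact not_reachable_delete he (hpt.symm.trans (h1.symm.trans hqh))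

theorem mem_cycleSide_or {e : Γ.Edge} {u : Fin n}
    {p : Γ.graph.Walk u u} (hp : p.IsCycle) (hu : Γ.graph.Reachable (Γ.tail N e) u) :
    Γ.tail N e ∈ Γ.cycleSide e ∨ Γ.head N e ∈ Γ.cycleSide e := by
  rcases reachable_delete_or (Γ.edge_eq_tail_head N e) hu with h | h | h
  · exact Or.inl ⟨u, p, hp, h.symm⟩
  · exact Or.inl ⟨u, p, hp, h.symm⟩
  · exact Or.inr ⟨u, p, hp, h.symm⟩

theorem IsTU.sum_unicyclicInverse_mul_ne_zero (h : Γ.IsTU) (hN : Γ.IsIncidenceMatrix N)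
    (e : Γ.Edge) : ∑ v, Γ.unicyclicInverse N e v * N v e ≠ 0 := by
  classical
  by_cases he : Γ.OnCycle e
  · rw [h.sum_unicyclicInverse_mul_of_onCycle hN he]; exact one_ne_zero
  · rw [sum_unicyclicInverse_mul_of_not_onCycle hN he]
    by_cases ht : Γ.tail N e ∈ Γ.cycleSide e
    · rw [if_pos ht, if_neg (h.not_mem_cycleSide he ht)]; norm_num
    · rw [if_neg ht]; split_ifs <;> norm_num

theorem IsTU.sum_unicyclicInverse_mul_self (h : Γ.IsTU) (hN : Γ.IsIncidenceMatrix N)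
    {e : Γ.Edge} {u : Fin n} {p : Γ.graph.Walk u u} (hp : p.IsCycle)
    (hu : Γ.graph.Reachable (Γ.tail N e) u) : ∑ v, Γ.unicyclicInverse N e v * N v e = 1 := by
  classical
  by_cases he : Γ.OnCycle e
  · exact h.sum_unicyclicInverse_mul_of_onCycle hN he
  · rw [sum_unicyclicInverse_mul_of_not_onCycle hN he]
    by_cases ht : Γ.tail N e ∈ Γ.cycleSide e
    · rw [if_pos ht, if_neg (h.not_mem_cycleSide he ht)]; norm_num
    · have := (mem_cycleSide_or (N := N) hp hu).resolve_left ht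
      rw [if_neg ht, if_pos this]; norm_num

end SignedGraph

/-! ### Rows of the tree formula, and their integrality -/

namespace SignedGraph

variable {n : ℕ} {Γ : SignedGraph n} {N : Matrix (Fin n) Γ.Edge ℝ}

theorem IsIncidenceMatrix.isInt_weight (hN : Γ.IsIncidenceMatrix N) (e : Γ.Edge) :
    ∃ m : ℤ, Γ.weight N e = m := by
  rw [hN.weight_eq]
  rcases hN.2.1 _ e (Γ.tail_mem N e) with h | h <;> rw [h]
  exacts [⟨1, by simp⟩, ⟨-1, by simp⟩]

theorem isInt_pathSign (a b : Fin n) : ∃ m : ℤ, Γ.pathSign a b = m := by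
  by_cases h : Γ.graph.Reachable a b
  · rcases pathSign_of_reachable h with h | h <;> rw [h]
    exacts [⟨1, by simp⟩, ⟨-1, by simp⟩]
  · exact ⟨0, by simp [pathSign_of_not_reachable h]⟩

theorem balancedAt_delete_of_isAcyclic (h : Γ.graph.IsAcyclic) (e : Γ.Edge) (a : Fin n) :
    (Γ.delete e).BalancedAt a := by
  intro u _ p hp
  obtain ⟨q, hq, _⟩ := exists_isCycle_of_delete (p := p) hp
  exact (h q hq).elim

theorem not_onCycle_of_isAcyclic (h : Γ.graph.IsAcyclic) (e : Γ.Edge) : ¬ Γ.OnCycle e := by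
  rintro ⟨u, p, hp, _⟩
  exact h p hp

/-- As for bridges in the unicyclic formula: each path sign vanishes on the other side, so the row
is a combination of two potentials of Γ∖e. -/
theorem treeInverse_eq (h : Γ.graph.IsTree) (e : Γ.Edge) (j : Fin n) :
    Γ.treeInverse N e j = Γ.weight N e / n *
      (((Γ.headComponent N e).ncard : ℝ) * (Γ.delete e).pathSign (Γ.tail N e) j -
        Γ.rsign e * ((Γ.tailComponent N e).ncard : ℝ) *
          (Γ.delete e).pathSign (Γ.head N e) j) := by
  rw [treeInverse, Matrix.of_apply]
  have he := not_onCycle_of_isAcyclic h.isAcyclic e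
  by_cases ht : j ∈ Γ.tailComponent N e
  · have h0 : (Γ.delete e).pathSign (Γ.head N e) j = 0 :=
      pathSign_of_not_reachable (not_mem_headComponent he ht)
    rw [edgePathSign, if_pos ht, if_pos ht, h0]
    ring
  · have h0 : (Γ.delete e).pathSign (Γ.tail N e) j = 0 := pathSign_of_not_reachable ht
    rw [edgePathSign, if_neg ht, if_neg ht, h0, rsign]
    ring

theorem ncard_tailComponent_add (h : Γ.graph.IsTree) (e : Γ.Edge) :
    ((Γ.tailComponent N e).ncard : ℝ) + ((Γ.headComponent N e).ncard : ℝ) = n := by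
  have hd : Disjoint (Γ.tailComponent N e) (Γ.headComponent N e) :=
    Set.disjoint_left.2 fun j hj =>
      not_mem_headComponent (not_onCycle_of_isAcyclic h.isAcyclic e) hj
  have hu : Γ.tailComponent N e ∪ Γ.headComponent N e = Set.univ := by
    refine Set.eq_univ_of_forall fun j => ?_
    rcases reachable_delete_or (Γ.edge_eq_tail_head N e)
      (h.connected.preconnected (Γ.tail N e) j) with h | h | h
    · exact Or.inl h
    · exact Or.inl h
    · exact Or.inr h
  have := Set.ncard_union_eq hd
  rw [hu, Set.ncard_univ, Nat.card_fin] at this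
  rw [← Nat.cast_add, ← this]

theorem isPotential_treeInverse (h : Γ.graph.IsTree) (e : Γ.Edge) :
    (Γ.delete e).IsPotential (Γ.treeInverse N e) := by
  have hb := balancedAt_delete_of_isAcyclic h.isAcyclic e
  have := (((isPotential_pathSign (hb (Γ.tail N e))).smul ((Γ.headComponent N e).ncard : ℝ)).sub
    ((isPotential_pathSign (hb (Γ.head N e))).smul
      (Γ.rsign e * ((Γ.tailComponent N e).ncard : ℝ)))).smul (Γ.weight N e / n)
  rwa [← funext (treeInverse_eq h e)] at this

theorem sum_treeInverse_mul_of_ne (h : Γ.graph.IsTree) (hN : Γ.IsIncidenceMatrix N)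
    {e f : Γ.Edge} (hf : f ≠ e) : ∑ v, Γ.treeInverse N e v * N v f = 0 :=
  (hN.sum_mul_eq_zero_iff _ f).2
    ((Γ.isPotential_delete_iff_tail_head N).1 (isPotential_treeInverse h e) f hf)

theorem sum_treeInverse_mul_self (hn : n ≠ 0) (h : Γ.graph.IsTree) (hN : Γ.IsIncidenceMatrix N)
    (e : Γ.Edge) : ∑ v, Γ.treeInverse N e v * N v e = 1 := by
  have hb := balancedAt_delete_of_isAcyclic h.isAcyclic e
  have hr : ¬ (Γ.delete e).graph.Reachable (Γ.tail N e) (Γ.head N e) :=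
    not_reachable_delete (not_onCycle_of_isAcyclic h.isAcyclic e)
  rw [hN.sum_mul, treeInverse_eq h, treeInverse_eq h, pathSign_self (hb _), pathSign_self (hb _),
    pathSign_of_not_reachable hr, pathSign_of_not_reachable fun h => hr h.symm]
  have h1 := ncard_tailComponent_add (N := N) h e
  have hn' : (n : ℝ) ≠ 0 := Nat.cast_ne_zero.2 hn
  have h6 := hN.weight_mul_self e
  have h7 := Γ.rsign_mul_self e
  generalize ((Γ.tailComponent N e).ncard : ℝ) = a at *
  generalize ((Γ.headComponent N e).ncard : ℝ) = b at *
  field_simp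
  linear_combination (b + Γ.rsign e * Γ.rsign e * a) * h6 + a * h7 + h1

open Classical in
theorem IsPotential.pathSign_mul {z : Fin n → ℝ} (hz : Γ.IsPotential z) (a b : Fin n) :
    Γ.pathSign a b * z b = if Γ.graph.Reachable a b then z a else 0 := by
  split_ifs with h
  · exact (hz.eq_pathSign h).symm
  · rw [pathSign_of_not_reachable h, zero_mul]

theorem IsPotential.sum_pathSign_mul {z : Fin n → ℝ} (hz : Γ.IsPotential z) (a : Fin n) :
    ∑ b, Γ.pathSign a b * z b = ({b | Γ.graph.Reachable a b}.ncard : ℝ) * z a := by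
  classical
  simp_rw [hz.pathSign_mul]
  rw [Finset.sum_ite, Finset.sum_const, Finset.sum_const_zero, add_zero, nsmul_eq_mul,
    Set.ncard_eq_toFinset_card', Set.toFinset_ofPred]

/-- Both sides of `e` contribute the product |T_t||T_h|, and the potential equation at `e` makes the
two contributions cancel. This orthogonality singles out the Moore-Penrose inverse among the left
inverses. -/
theorem sum_treeInverse_mul_potential (h : Γ.graph.IsTree) (e : Γ.Edge) {z : Fin n → ℝ}
    (hz : Γ.IsPotential z) : ∑ v, Γ.treeInverse N e v * z v = 0 := by
  have h1 := (hz.delete e).sum_pathSign_mul (Γ.tail N e)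
  have h2 := (hz.delete e).sum_pathSign_mul (Γ.head N e)
  change _ = ((Γ.tailComponent N e).ncard : ℝ) * _ at h1
  change _ = ((Γ.headComponent N e).ncard : ℝ) * _ at h2
  have h3 : ∑ v, Γ.treeInverse N e v * z v = Γ.weight N e / n *
      (((Γ.headComponent N e).ncard : ℝ) *
          ∑ v, (Γ.delete e).pathSign (Γ.tail N e) v * z v -
        Γ.rsign e * ((Γ.tailComponent N e).ncard : ℝ) *
          ∑ v, (Γ.delete e).pathSign (Γ.head N e) v * z v) := by
    rw [Finset.mul_sum, Finset.mul_sum, ← Finset.sum_sub_distrib, Finset.mul_sum]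
    refine Finset.sum_congr rfl fun v _ => ?_
    rw [treeInverse_eq h]; ring
  rw [h3, h1, h2, (Γ.isPotential_iff_tail_head N).1 hz e]
  ring

/-- Up to the switching function `z`, the entries in a row of `treeInverse` differ by integers. -/
theorem treeInverse_mul_potential_sub (hn : n ≠ 0) (h : Γ.graph.IsTree) (hN : Γ.IsIncidenceMatrix N)
    (e : Γ.Edge) {z : Fin n → ℝ} (hz : Γ.IsPotential z) (hz1 : ∀ v, z v = 1 ∨ z v = -1)
    (a b : Fin n) :
    ∃ m : ℤ, Γ.treeInverse N e a * z a - Γ.treeInverse N e b * z b = m := by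
  classical
  -- Multiplied by z, the row takes only two values, one on each side of `e`, and they differ by
  -- w(e) z(tail).
  have key : ∀ j, Γ.treeInverse N e j * z j = Γ.weight N e * z (Γ.tail N e) / n *
      ((if j ∈ Γ.tailComponent N e then (n : ℝ) else 0) - ((Γ.tailComponent N e).ncard : ℝ)) := by
    intro j
    have h1 := (hz.delete e).pathSign_mul (Γ.tail N e) j
    have h2 := (hz.delete e).pathSign_mul (Γ.head N e) j
    have h3 := (Γ.isPotential_iff_tail_head N).1 hz e
    have h4 := ncard_tailComponent_add (N := N) h e
    have h5 : Γ.treeInverse N e j * z j = Γ.weight N e / n *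
      (((Γ.headComponent N e).ncard : ℝ) * ((Γ.delete e).pathSign (Γ.tail N e) j * z j) -
        Γ.rsign e * ((Γ.tailComponent N e).ncard : ℝ) *
          ((Γ.delete e).pathSign (Γ.head N e) j * z j)) := by
      rw [treeInverse_eq h]; ring
    rw [h5, h1, h2]
    by_cases ht : j ∈ Γ.tailComponent N e
    · have hh : ¬ (Γ.delete e).graph.Reachable (Γ.head N e) j :=
        not_mem_headComponent (not_onCycle_of_isAcyclic h.isAcyclic e) ht
      rw [if_pos ht, if_neg hh, if_pos (show (Γ.delete e).graph.Reachable _ _ from ht), ← h4]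
      ring
    · have hh : (Γ.delete e).graph.Reachable (Γ.head N e) j := by
        rcases reachable_delete_or (Γ.edge_eq_tail_head N e)
          (h.connected.preconnected (Γ.tail N e) j) with h | h | h
        · exact absurd h ht
        · exact absurd h ht
        · exact h
      rw [if_neg ht, if_neg (show ¬ (Γ.delete e).graph.Reachable _ _ from ht), if_pos hh, h3]
      ring
  have hn' : (n : ℝ) ≠ 0 := Nat.cast_ne_zero.2 hn
  have hz' : ∃ m : ℤ, z (Γ.tail N e) = m := by
    rcases hz1 (Γ.tail N e) with h | h <;> rw [h]
    exacts [⟨1, by simp⟩, ⟨-1, by simp⟩]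
  obtain ⟨w, hw⟩ := hN.isInt_weight e
  obtain ⟨s, hs⟩ := hz'
  refine ⟨w * s * ((if a ∈ Γ.tailComponent N e then 1 else 0) -
    (if b ∈ Γ.tailComponent N e then 1 else 0)), ?_⟩
  rw [key, key, hw, hs]
  push_cast
  split_ifs <;> field_simp <;> ring

theorem mul_treeInverse_isInt (hn : n ≠ 0) (h : Γ.graph.IsTree) (hN : Γ.IsIncidenceMatrix N)
    (e : Γ.Edge) (a : Fin n) : ∃ m : ℤ, n * Γ.treeInverse N e a = m := by
  obtain ⟨w, hw⟩ := hN.isInt_weight e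
  obtain ⟨p, hp1⟩ := isInt_pathSign (Γ := Γ.delete e) (Γ.tail N e) a
  obtain ⟨q, hq1⟩ := isInt_pathSign (Γ := Γ.delete e) (Γ.head N e) a
  have hn' : (n : ℝ) ≠ 0 := Nat.cast_ne_zero.2 hn
  refine ⟨w * ((Γ.headComponent N e).ncard * p -
    (Γ.sign e : ℤ) * (Γ.tailComponent N e).ncard * q), ?_⟩
  rw [treeInverse_eq h, hw, hp1, hq1, rsign]
  push_cast
  field_simp

end SignedGraph

/-! ### Determinants from integrality, Cramer's rule, and the exchange of column bases -/

namespace Matrix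

variable {V E ι : Type*} [Fintype V] [DecidableEq V]

/-- A real matrix with integer entries and an inverse with integer entries has determinant
`1` or `-1`. -/
theorem det_sq_eq_one_of_isInt {A B : Matrix V V ℝ} (h : A * B = 1)
    (hA : ∀ i j, ∃ m : ℤ, A i j = m) (hB : ∀ i j, ∃ m : ℤ, B i j = m) : A.det ^ 2 = 1 := by
  choose A' hA' using hA
  choose B' hB' using hB
  have h1 : A.det = ((Matrix.of A').det : ℤ) := by
    rw [Int.cast_det]; congr 1; ext i j; exact hA' i j
  have h2 : B.det = ((Matrix.of B').det : ℤ) := by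
    rw [Int.cast_det]; congr 1; ext i j; exact hB' i j
  have h3 : A.det * B.det = 1 := by rw [← det_mul, h, det_one]
  rw [h1, h2, ← Int.cast_mul, ← Int.cast_one, Int.cast_inj] at h3
  rw [h1, ← Int.cast_pow, sq, Int.isUnit_mul_self (IsUnit.of_mul_eq_one _ h3), Int.cast_one]

/-- Adding to the row of each representative the other rows of its class (the matrix 1 + R, with R²
= 0) makes that row divisible by k. Dividing out k leaves an integer matrix C' with inverse B(1 -
R)K, which is integral by `h2` and `h3`. So C' is unimodular, and det A is, up to sign, a factor k
for each representative. -/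
theorem det_sq_of_root_aux {A B : Matrix V V ℝ} (h : A * B = 1)
    (hA : ∀ i j, ∃ m : ℤ, A i j = m) (ρ : V → V) (hρ : ∀ v, ρ (ρ v) = ρ v) {k : ℕ}
    (h1 : ∀ r, ρ r = r → ∀ e, ∃ m : ℤ, ∑ v, (if ρ v = r then A v e else 0) = k * m)
    (h2 : ∀ e w, ∃ m : ℤ, B e w - B e (ρ w) = m)
    (h3 : ∀ e w, ∃ m : ℤ, k * B e w = m) :
    A.det ^ 2 = ((k : ℝ) ^ 2) ^ (Finset.univ.filter fun v => ρ v = v).card := by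
  let R : Matrix V V ℝ := Matrix.of fun i v => if ρ v = i ∧ v ≠ i then 1 else 0
  have hR : R * R = 0 := by
    ext i w
    rw [mul_apply]
    refine Finset.sum_eq_zero fun v _ => ?_
    simp only [R, of_apply, mul_ite, mul_one, mul_zero]
    split_ifs with h1 h2
    · exact absurd (by rw [← h2.1, ← h1.1, hρ]) h2.2
    · rfl
    · rfl
  have hRint : ∀ i j, ∃ m : ℤ, R i j = m := fun i j =>
    ⟨if ρ j = i ∧ j ≠ i then 1 else 0, by simp [R]⟩
  have hone : ∀ i j, ∃ m : ℤ, (1 : Matrix V V ℝ) i j = m := fun i j =>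
    ⟨if i = j then 1 else 0, by simp [one_apply]⟩
  have hPQ : (1 + R) * (1 - R) = 1 := by
    rw [mul_sub, mul_one, add_mul, one_mul, hR, add_zero, add_sub_cancel_right]
  have hQP : (1 - R) * (1 + R) = 1 := mul_eq_one_comm.1 hPQ
  have hdP : (1 + R).det ^ 2 = 1 := by
    refine det_sq_eq_one_of_isInt hPQ (fun i j => ?_) fun i j => ?_
    · obtain ⟨a, ha⟩ := hone i j
      obtain ⟨b, hb⟩ := hRint i j
      exact ⟨a + b, by rw [add_apply, ha, hb, Int.cast_add]⟩
    · obtain ⟨a, ha⟩ := hone i j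
      obtain ⟨b, hb⟩ := hRint i j
      exact ⟨a - b, by rw [sub_apply, ha, hb, Int.cast_sub]⟩
  have hPA : ∀ i e, ∃ m : ℤ, ((1 + R) * A) i e = (if ρ i = i then (k : ℝ) else 1) * m := by
    intro i e
    by_cases hi : ρ i = i
    · obtain ⟨m, hm⟩ := h1 i hi e
      refine ⟨m, ?_⟩
      rw [if_pos hi, ← hm, mul_apply]
      refine Finset.sum_congr rfl fun v _ => ?_
      by_cases hv : v = i
      · subst hv; simp [R, hi]
      · by_cases hv' : ρ v = i
        · simp [R, hv, hv', one_apply_ne (Ne.symm hv)]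
        · simp [R, hv', one_apply_ne (Ne.symm hv)]
    · obtain ⟨m, hm⟩ := hA i e
      refine ⟨m, ?_⟩
      rw [if_neg hi, one_mul, ← hm, add_mul, one_mul, add_apply, add_eq_left, mul_apply]
      refine Finset.sum_eq_zero fun v _ => ?_
      have : ¬ ρ v = i := fun hv => hi (by rw [← hv, hρ])
      simp [R, this]
  choose C hC using hPA
  let K : Matrix V V ℝ := diagonal fun i => if ρ i = i then (k : ℝ) else 1
  let C' : Matrix V V ℝ := Matrix.of fun i e => (C i e : ℝ)
  have hKC : K * C' = (1 + R) * A := by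
    ext i e
    rw [diagonal_mul, hC]; rfl
  have hBR : ∀ e w, (B * (1 - R)) e w = B e w - if ρ w = w then 0 else B e (ρ w) := by
    intro e w
    rw [mul_sub, mul_one, sub_apply, mul_apply]
    congr 1
    rw [Finset.sum_eq_single (ρ w)]
    · by_cases hw : ρ w = w
      · simp [R, hw]
      · simp [R, hw, Ne.symm hw]
    · intro v _ hv
      simp [R, Ne.symm hv]
    · simp
  have hE : ∀ i j, ∃ m : ℤ, (B * (1 - R) * K) i j = m := by
    intro e w
    rw [mul_diagonal, hBR]
    by_cases hw : ρ w = w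
    · obtain ⟨m, hm⟩ := h3 e w
      exact ⟨m, by rw [if_pos hw, if_pos hw, sub_zero, mul_comm, hm]⟩
    · obtain ⟨m, hm⟩ := h2 e w
      exact ⟨m, by rw [if_neg hw, if_neg hw, mul_one, hm]⟩
  have hEC : C' * (B * (1 - R) * K) = 1 := by
    rw [mul_eq_one_comm, mul_assoc, hKC, mul_assoc, ← mul_assoc (1 - R), hQP, one_mul,
      mul_eq_one_comm, h]
  have hdC : C'.det ^ 2 = 1 := det_sq_eq_one_of_isInt hEC (fun i j => ⟨_, rfl⟩) hE
  have hdet : K.det * C'.det = (1 + R).det * A.det := by rw [← det_mul, ← det_mul, hKC]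
  have hK : K.det = (k : ℝ) ^ (Finset.univ.filter fun v => ρ v = v).card := by
    rw [det_diagonal, Finset.prod_ite, Finset.prod_const, Finset.prod_const_one, mul_one]
  calc A.det ^ 2 = (1 + R).det ^ 2 * A.det ^ 2 := by rw [hdP, one_mul]
    _ = ((1 + R).det * A.det) ^ 2 := by ring
    _ = K.det ^ 2 * C'.det ^ 2 := by rw [← hdet]; ring
    _ = _ := by rw [hdC, hK, mul_one, ← pow_mul, ← pow_mul, mul_comm]

/-- The determinant of an integer matrix `A` whose inverse `B` has denominator `k`, if the
(signed) sum of the rows over each class of a partition of the row indices is divisible by `k` and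
the columns of `B` are integers modulo the column of the class representative. -/
theorem det_sq_of_root {A B : Matrix V V ℝ} (h : A * B = 1)
    (hA : ∀ i j, ∃ m : ℤ, A i j = m) (s : V → ℝ) (hs : ∀ v, s v = 1 ∨ s v = -1)
    (ρ : V → V) (hρ : ∀ v, ρ (ρ v) = ρ v) {k : ℕ}
    (h1 : ∀ r, ρ r = r → ∀ e, ∃ m : ℤ, ∑ v, (if ρ v = r then s v * A v e else 0) = k * m)
    (h2 : ∀ e w, ∃ m : ℤ, B e w * s w - B e (ρ w) * s (ρ w) = m)
    (h3 : ∀ e w, ∃ m : ℤ, k * B e w = m) :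
    A.det ^ 2 = ((k : ℝ) ^ 2) ^ (Finset.univ.filter fun v => ρ v = v).card := by
  have hss : ∀ v, s v * s v = 1 := fun v => by rcases hs v with h | h <;> rw [h] <;> norm_num
  have hsi : ∀ v, ∃ m : ℤ, s v = m := fun v => by
    rcases hs v with h | h <;> rw [h]
    exacts [⟨1, by simp⟩, ⟨-1, by simp⟩]
  have hd : (diagonal s).det ^ 2 = 1 := by
    rw [det_diagonal, ← Finset.prod_pow]
    exact Finset.prod_eq_one fun v _ => by rw [sq, hss]
  have hdd : diagonal s * diagonal s = 1 := by
    rw [diagonal_mul_diagonal, ← diagonal_one]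
    congr 1
    exact funext hss
  have := det_sq_of_root_aux (A := diagonal s * A) (B := B * diagonal s) (k := k)
    (by rw [mul_assoc, ← mul_assoc A, h, one_mul, hdd]) (fun i j => by
      obtain ⟨a, ha⟩ := hsi i
      obtain ⟨b, hb⟩ := hA i j
      exact ⟨a * b, by rw [diagonal_mul, ha, hb, Int.cast_mul]⟩) ρ hρ
    (by simpa only [diagonal_mul] using h1) (by simpa only [mul_diagonal] using h2)
    (fun e w => by
      obtain ⟨a, ha⟩ := hsi w
      obtain ⟨b, hb⟩ := h3 e w
      exact ⟨b * a, by rw [mul_diagonal, ← mul_assoc, ha, hb, Int.cast_mul]⟩)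
  rw [det_mul, mul_pow, hd, one_mul] at this
  exact this

theorem submatrix_mul_submatrix_of_range {V E : Type*} [Fintype V] [Fintype E] {M : Matrix V E ℝ} {D : Matrix E V ℝ} {S : Set E}
    (hD : ∀ e ∉ S, ∀ v, D e v = 0) {g : V → E} (hg : Function.Injective g)
    (hgS : Set.range g = S) : M.submatrix id g * D.submatrix g id = M * D := by
  ext i j
  rw [mul_apply, mul_apply]
  refine Fintype.sum_of_injective g hg _ _ (fun e he => ?_) fun v => rfl
  rw [hD e (hgS ▸ he), mul_zero]

variable [Fintype E]

/-- Cramer's rule: `D` restricted to the rows `g` inverts the chosen square submatrix, so an entry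
of `D * M` is a quotient of two maximal minors. -/
theorem det_mul_eq_det_update {M : Matrix V E ℝ} {D : Matrix E V ℝ} {S : Set E}
    (hMD : M * D = 1) (hD : ∀ e ∉ S, ∀ v, D e v = 0) {g : V → E} (hg : Function.Injective g)
    (hgS : Set.range g = S) (k : V) (f : E) :
    (M.submatrix id g).det * (D * M) (g k) f =
      (M.submatrix id (Function.update g k f)).det := by
  have h1 : M.submatrix id g * D.submatrix g id = 1 := by
    rw [submatrix_mul_submatrix_of_range hD hg hgS, hMD]
  have h2 : (M.submatrix id g).adjugate = (M.submatrix id g).det • D.submatrix g id := by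
    calc (M.submatrix id g).adjugate
        = (M.submatrix id g).adjugate * (M.submatrix id g * D.submatrix g id) := by
          rw [h1, mul_one]
      _ = _ := by rw [← mul_assoc, adjugate_mul, smul_mul, one_mul]
  have h3 : M.submatrix id (Function.update g k f) =
      (M.submatrix id g).updateCol k (M.col f) := by
    ext i j
    by_cases hj : j = k
    · subst hj; simp
    · simp [hj]
  rw [h3, ← cramer_apply, cramer_eq_adjugate_mulVec, h2, smul_mulVec, Pi.smul_apply, smul_eq_mul]
  rfl

/-- The volume-weighted average of the inverses of the maximal nonsingular square column
submatrices of `M` is the Moore-Penrose inverse of `M`; this is its symmetry property. -/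
theorem isSymm_sum_smul_mul (M : Matrix V E ℝ) (F : Finset ι) (S : ι → Set E)
    (hS : ∀ H ∈ F, ∀ H' ∈ F, S H = S H' → H = H') (D : ι → Matrix E V ℝ) (w : ι → ℝ)
    (hcard : ∀ H ∈ F, (S H).ncard = Fintype.card V)
    (hMD : ∀ H ∈ F, M * D H = 1) (hD : ∀ H ∈ F, ∀ e ∉ S H, ∀ v, D H e v = 0)
    (hw : ∀ H ∈ F, ∀ g : V → E, Function.Injective g → Set.range g = S H →
      (M.submatrix id g).det ^ 2 = w H)
    (hF : ∀ g : V → E, Function.Injective g → (M.submatrix id g).det ≠ 0 →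
      ∃ H ∈ F, Set.range g = S H) :
    ((∑ H ∈ F, w H • D H) * M).transpose = (∑ H ∈ F, w H • D H) * M := by
  -- The term at (e,f) is a product of the minors of H and H' = H - e + f, an expression symmetric
  -- in the two bases. Enumerating H' by the update of the enumeration of H keeps the signs of the
  -- minors consistent.
  have claim : ∀ e f, e ≠ f → ∀ H ∈ F, w H * (D H * M) e f ≠ 0 →
      e ∈ S H ∧ f ∉ S H ∧ ∃ H' ∈ F, S H' = insert f (S H \ {e}) ∧
        w H * (D H * M) e f = w H' * (D H' * M) f e := by
    intro e f hef H hH hne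
    have heS : e ∈ S H := by
      by_contra he
      refine hne ?_
      rw [mul_apply, Finset.sum_eq_zero, mul_zero]
      intro v _
      rw [hD H hH e he, zero_mul]
    have hfin : Nat.card V = Nat.card (S H) := by
      rw [Nat.card_eq_fintype_card, ← hcard H hH]; rfl
    obtain ⟨φ⟩ : Nonempty (V ≃ S H) := Finite.card_eq.1 hfin
    obtain ⟨g, hgdef⟩ : ∃ g : V → E, g = fun v => (φ v : E) := ⟨_, rfl⟩
    have hg : Function.Injective g := by
      rw [hgdef]; exact Subtype.val_injective.comp φ.injective
    have hgS : Set.range g = S H := by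
      rw [hgdef]
      change Set.range (Subtype.val ∘ φ) = _
      rw [φ.surjective.range_comp, Subtype.range_val]
    obtain ⟨k, rfl⟩ : ∃ k, g k = e := by rwa [← hgS] at heS
    have h1 := det_mul_eq_det_update (hMD H hH) (hD H hH) hg hgS k f
    have h2 : w H * (D H * M) (g k) f = (M.submatrix id g).det *
        (M.submatrix id (Function.update g k f)).det := by
      rw [← hw H hH g hg hgS, ← h1]; ring
    have h3 : (M.submatrix id (Function.update g k f)).det ≠ 0 := fun h => hne (by
      rw [h2, h, mul_zero])
    have hfS : f ∉ S H := by
      rw [← hgS]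
      rintro ⟨k', rfl⟩
      have hk : k ≠ k' := fun h => hef (by rw [h])
      refine h3 (det_zero_of_column_eq hk fun i => ?_)
      simp [hk.symm]
    have hg' : Function.Injective (Function.update g k f) := by
      have hf : ∀ v, g v ≠ f := fun v h => hfS (hgS ▸ ⟨v, h⟩)
      intro a b hab
      by_cases ha : a = k <;> by_cases hb : b = k
      · rw [ha, hb]
      · subst ha; simp [hb] at hab; exact absurd hab.symm (hf b)
      · subst hb; simp [ha] at hab; exact absurd hab (hf a)
      · simp [ha, hb] at hab; exact hg hab
    have hr : Set.range (Function.update g k f) = insert f (S H \ {g k}) := by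
      rw [← hgS]
      ext x
      constructor
      · rintro ⟨v, rfl⟩
        by_cases hv : v = k
        · subst hv; simp
        · simp [hv, hg.eq_iff]
      · rintro (rfl | ⟨⟨v, rfl⟩, hv⟩)
        · exact ⟨k, by simp⟩
        · have : v ≠ k := fun h => hv (by rw [h]; rfl)
          exact ⟨v, by simp [this]⟩
    obtain ⟨H', hH', hgH'⟩ := hF _ hg' h3
    refine ⟨heS, hfS, H', hH', by rw [← hgH', hr], ?_⟩
    have h4 := det_mul_eq_det_update (hMD H' hH') (hD H' hH') hg' hgH' k (g k)
    -- Replacing `f` by `e` again restores the original enumeration, so Cramer's rule for H' yields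
    -- the same two minors.
    rw [Function.update_self, Function.update_idem, Function.update_eq_self] at h4
    rw [h2, ← hw H' hH' _ hg' hgH', ← h4]; ring
  have hsum : ∀ e f, ((∑ H ∈ F, w H • D H) * M) e f = ∑ H ∈ F, w H * (D H * M) e f := by
    intro e f
    rw [Matrix.sum_mul, sum_apply]
    exact Finset.sum_congr rfl fun H _ => by rw [smul_mul, smul_apply, smul_eq_mul]
  ext f e
  rw [transpose_apply, hsum, hsum]
  by_cases hef : e = f
  · rw [hef]
  choose hmem hnot i hiF hiS hi using claim e f hef
  have hback : ∀ H (hH : H ∈ F) hne, insert e (S (i H hH hne) \ {f}) = S H := by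
    intro H hH hne
    have he := hmem H hH hne
    have hf := hnot H hH hne
    rw [hiS]
    ext x
    by_cases hxe : x = e
    · simp [hxe, he]
    · by_cases hxf : x = f
      · simp [hxf, hf, Ne.symm hef]
      · simp [hxe, hxf]
  -- H ↦ H - e + f is a bijection between the nonzero terms at (e,f) and those at (f,e); exchanging
  -- back inverts it.
  refine Finset.sum_bij_ne_zero i hiF (fun H1 h1 h1' H2 h2 h2' heq => ?_) (fun H hH hne => ?_) hi
  · exact hS H1 h1 H2 h2 (by rw [← hback H1 h1 h1', ← hback H2 h2 h2', heq])
  · obtain ⟨hf, he, H', hH', hSH', hval⟩ := claim f e (Ne.symm hef) H hH hne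
    have hne' : w H' * (D H' * M) e f ≠ 0 := hval ▸ hne
    refine ⟨H', hH', hne', hS _ (hiF _ _ _) _ hH ?_⟩
    rw [hiS, hSH']
    ext x
    by_cases hxe : x = e
    · simp [hxe, he, hef]
    · by_cases hxf : x = f
      · simp [hxf, hf]
      · simp [hxe, hxf]

/-- Independent rows force full column rank, so the columns contain a basis. -/
theorem exists_submatrix_det_ne_zero (M : Matrix V E ℝ)
    (hM : ∀ z : V → ℝ, z ᵥ* M = 0 → z = 0) :
    ∃ g : V → E, Function.Injective g ∧ (M.submatrix id g).det ≠ 0 := by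
  have h1 : LinearIndependent ℝ M.row := by
    rw [← vecMul_injective_iff]
    intro x y hxy
    have : (x - y) ᵥ* M = 0 := by rw [sub_vecMul]; exact sub_eq_zero.2 hxy
    exact sub_eq_zero.1 (hM _ this)
  have h2 := h1.rank_matrix
  rw [rank_eq_finrank_span_cols] at h2
  have h3 : Submodule.span ℝ (Set.range M.col) = ⊤ :=
    Submodule.eq_top_of_finrank_eq (by rw [h2, Module.finrank_pi])
  obtain ⟨κ, a, ha, hspan, hli⟩ := exists_linearIndependent' ℝ M.col
  have : Finite κ := Finite.of_injective a ha
  have : Fintype κ := Fintype.ofFinite κ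
  have h4 : Fintype.card V = Fintype.card κ := by
    have h5 := finrank_span_eq_card hli
    rw [hspan, h2] at h5
    exact h5
  let φ := Fintype.equivOfCardEq h4
  refine ⟨a ∘ φ, ha.comp φ.injective, ?_⟩
  rw [← isUnit_iff_ne_zero, ← isUnit_iff_isUnit_det, ← linearIndependent_cols_iff_isUnit]
  exact hli.comp φ φ.injective

end Matrix

/-! ### Nonsingular signed graphs with n edges -/

namespace SignedGraph

variable {n : ℕ} {Γ : SignedGraph n} {N : Matrix (Fin n) Γ.Edge ℝ}

/-- Without the column of `e` there remain n - 1 linear equations in n unknowns. -/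
theorem exists_isPotential_delete (hN : Γ.IsIncidenceMatrix N) (hcard : Fintype.card Γ.Edge = n)
    (e : Γ.Edge) : ∃ z : Fin n → ℝ, z ≠ 0 ∧ (Γ.delete e).IsPotential z := by
  classical
  have φ : Fin n ≃ Γ.Edge := Fintype.equivOfCardEq (by rw [Fintype.card_fin, hcard])
  have hdet : ((N.submatrix id φ).updateCol (φ.symm e) 0).det = 0 :=
    Matrix.det_eq_zero_of_column_eq_zero (φ.symm e) fun i => by simp
  obtain ⟨z, hz, hz0⟩ := Matrix.exists_vecMul_eq_zero_iff.2 hdet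
  refine ⟨z, hz, (Γ.isPotential_delete_iff_tail_head N).2 fun f hf => ?_⟩
  rw [← hN.sum_mul_eq_zero_iff]
  have h := congrFun hz0 (φ.symm f)
  have hne : φ.symm f ≠ φ.symm e := fun h => hf (φ.symm.injective h)
  simpa [Matrix.vecMul, dotProduct, Matrix.updateCol_apply, hne] using h

/-- Let e lie on an even cycle. A nonzero potential z of Γ∖e is not one of Γ, so it has the wrong
sign at e. Going round the cycle crosses e once, which gives z = -z at the base point. Then z
vanishes at both ends of e and satisfies the equation there after all. -/
theorem not_even_of_isPotential_eq_zero (hN : Γ.IsIncidenceMatrix N)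
    (hcard : Fintype.card Γ.Edge = n)
    (h0 : ∀ z, Γ.IsPotential z → z = 0) {u : Fin n} {p : Γ.graph.Walk u u} (hp : p.IsCycle) :
    ¬ Even (Γ.negCount p) := by
  intro hev
  obtain ⟨f, hf⟩ : ∃ f, f ∈ p.edges := List.exists_mem_of_ne_nil _ fun h =>
    hp.ne_nil (Walk.edges_eq_nil.1 h).eq_nil
  let e : Γ.Edge := ⟨f, p.edges_subset_edgeSet hf⟩
  have he : Γ.OnCycle e := ⟨u, p, hp, hf⟩
  obtain ⟨z, hz, hzp⟩ := exists_isPotential_delete hN hcard e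
  have hth := (onCycle_iff (Γ.edge_eq_tail_head N e)).1 he
  have hne : z (Γ.tail N e) ≠ Γ.rsign e * z (Γ.head N e) := fun h =>
    hz (h0 z (IsPotential.of_delete hzp h))
  have hflip : z (Γ.tail N e) = -Γ.rsign e * z (Γ.head N e) := by
    rcases hzp.sq_eq hth with h1 | h1 <;> rcases Γ.rsign_eq e with h2 | h2 <;>
      rw [h2] at hne ⊢ <;> first | linarith | exact absurd (by linarith) hne
  have hw := walk_of_flip e (isPotential_delete_iff.1 hzp) (fun a b hab hab' => by
    have he' : (⟨s(a, b), hab⟩ : Γ.Edge) = e := Subtype.ext hab'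
    rw [he']
    rw [Γ.edge_eq_tail_head N e] at hab'
    rcases Sym2.eq_iff.1 hab' with ⟨h1, h2⟩ | ⟨h1, h2⟩
    · rw [h1, h2, hflip]
    · rw [h1, h2, hflip, ← mul_assoc, neg_mul_neg, rsign_mul_self, one_mul]) p
  have hcount : p.edges.count e.1 = 1 :=
    List.count_eq_one_of_mem hp.isTrail.edges_nodup hf
  rw [hcount, Γ.rwalkSign_of_even hev] at hw
  have hu : z u = 0 := by linarith
  have hm : Γ.tail N e ∈ p.support := by
    refine Walk.fst_mem_support_of_mem_edges (u := Γ.head N e) _ ?_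
    rw [← Γ.edge_eq_tail_head N e]; exact hf
  have ht : z (Γ.tail N e) = 0 := by
    rcases hzp.sq_eq (he.reachable_delete (p.takeUntil _ hm).reachable) with h | h <;>
      linarith
  have hh : z (Γ.head N e) = 0 := by
    rcases hzp.sq_eq hth with h | h <;> linarith
  exact hne (by rw [ht, hh, mul_zero])

/-- If f is missing from q, a nonzero potential of Γ∖f is killed on q, because q is odd. As f lies
on the cycle p, deleting it does not disconnect the component, so the potential vanishes at the ends
of f and is a potential of Γ, a contradiction. -/
theorem mem_edges_of_isPotential_eq_zero (hN : Γ.IsIncidenceMatrix N)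
    (hcard : Fintype.card Γ.Edge = n)
    (h0 : ∀ z, Γ.IsPotential z → z = 0) {u v : Fin n} (huv : Γ.graph.Reachable u v)
    {p : Γ.graph.Walk u u} (hp : p.IsCycle) {q : Γ.graph.Walk v v} (hq : q.IsCycle)
    {f : Sym2 (Fin n)} (hf : f ∈ p.edges) : f ∈ q.edges := by
  by_contra hfq
  let e : Γ.Edge := ⟨f, p.edges_subset_edgeSet hf⟩
  have he : Γ.OnCycle e := ⟨u, p, hp, hf⟩
  obtain ⟨z, hz, hzp⟩ := exists_isPotential_delete hN hcard e
  have h1 := hzp.walk_of_delete q hfq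
  rw [Γ.rwalkSign_of_not_even (not_even_of_isPotential_eq_zero hN hcard h0 hq)] at h1
  have hv : z v = 0 := by linarith
  have hm : Γ.tail N e ∈ p.support := by
    refine Walk.fst_mem_support_of_mem_edges (u := Γ.head N e) _ ?_
    rw [← Γ.edge_eq_tail_head N e]; exact hf
  have hr := (p.takeUntil _ hm).reachable
  have ht : z (Γ.tail N e) = 0 := by
    rcases hzp.sq_eq (he.reachable_delete (huv.symm.trans hr)) with h | h <;> linarith
  have hh : z (Γ.head N e) = 0 := by
    rcases hzp.sq_eq ((onCycle_iff (Γ.edge_eq_tail_head N e)).1 he) with h | h <;> linarith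
  exact hz (h0 z (IsPotential.of_delete hzp (by rw [ht, hh, mul_zero])))

/-- A signed graph with as many edges as vertices and nonsingular incidence matrix has only
unbalanced unicyclic components. -/
theorem isUnbalancedUnicyclicComponent_of_isPotential_eq_zero (hN : Γ.IsIncidenceMatrix N)
    (hcard : Fintype.card Γ.Edge = n)
    (h0 : ∀ z, Γ.IsPotential z → z = 0) (c : Γ.graph.ConnectedComponent) :
    Γ.IsUnbalancedUnicyclicComponent c := by
  refine ⟨?_, fun u _ p hp => not_even_of_isPotential_eq_zero hN hcard h0 hp⟩
  induction c using ConnectedComponent.ind with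
  | _ a =>
    -- Every component contains a cycle, since otherwise its path signs would form a nonzero
    -- potential.
    have ha : ¬ Γ.BalancedAt a := fun hb => by
      have h1 := congrFun (h0 _ (isPotential_pathSign hb)) a
      rw [pathSign_self hb] at h1
      exact one_ne_zero h1
    unfold BalancedAt at ha
    push Not at ha
    obtain ⟨u, hu, p, hp, -⟩ := ha
    refine ⟨{f | f ∈ p.edges}, Set.eq_singleton_iff_unique_mem.2
      ⟨⟨u, ConnectedComponent.eq.2 hu.symm, p, hp, rfl⟩, ?_⟩⟩
    rintro C ⟨v, hv, q, hq, rfl⟩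
    have huv : Γ.graph.Reachable u v := hu.symm.trans (ConnectedComponent.eq.1 hv).symm
    ext f
    exact ⟨mem_edges_of_isPotential_eq_zero hN hcard h0 huv.symm hq hp,
      mem_edges_of_isPotential_eq_zero hN hcard h0 huv hp hq⟩

/-- The formula times `N` is diagonal with nonzero entries; after rescaling it is a left inverse of
`N`, hence two-sided, as there are n edges. Knowing this excludes tree components, after which the
diagonal entries turn out to be 1. -/
theorem IsTU.isPotential_eq_zero (h : Γ.IsTU) (hN : Γ.IsIncidenceMatrix N)
    (hcard : Fintype.card Γ.Edge = n) (z : Fin n → ℝ) (hz : Γ.IsPotential z) : z = 0 := by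
  let d : Γ.Edge → ℝ := fun e => ∑ v, Γ.unicyclicInverse N e v * N v e
  have h1 : Γ.unicyclicInverse N * N = Matrix.diagonal d := by
    ext e f
    rw [Matrix.mul_apply]
    by_cases hef : f = e
    · rw [hef, Matrix.diagonal_apply_eq]
    · rw [h.sum_unicyclicInverse_mul_of_ne hN hef, Matrix.diagonal_apply_ne _ (Ne.symm hef)]
  have h2 : Matrix.diagonal (fun e => (d e)⁻¹) * Γ.unicyclicInverse N * N = 1 := by
    rw [Matrix.mul_assoc, h1, Matrix.diagonal_mul_diagonal, ← Matrix.diagonal_one]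
    congr 1
    exact funext fun e => inv_mul_cancel₀ (h.sum_unicyclicInverse_mul_ne_zero hN e)
  have h3 := (Matrix.mul_eq_one_comm_of_card_eq _ _ _
    (by rw [hcard, Fintype.card_fin])).1 h2
  have h4 : Matrix.vecMul z N = 0 := funext fun e => hN.isPotential_iff.1 hz e
  rw [← Matrix.vecMul_one z, ← h3, ← Matrix.vecMul_vecMul, h4, Matrix.zero_vecMul]

theorem IsTU.isUnbalancedUnicyclicComponent (h : Γ.IsTU) (hN : Γ.IsIncidenceMatrix N)
    (hcard : Fintype.card Γ.Edge = n) (c : Γ.graph.ConnectedComponent) :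
    Γ.IsUnbalancedUnicyclicComponent c :=
  isUnbalancedUnicyclicComponent_of_isPotential_eq_zero hN hcard
    (h.isPotential_eq_zero hN hcard) c

theorem IsTU.unicyclicInverse_mul (h : Γ.IsTU) (hN : Γ.IsIncidenceMatrix N)
    (hcard : Fintype.card Γ.Edge = n) : Γ.unicyclicInverse N * N = 1 := by
  ext e f
  rw [Matrix.mul_apply]
  by_cases hef : f = e
  · rw [hef, Matrix.one_apply_eq]
    obtain ⟨⟨C, hC⟩, _⟩ :=
      h.isUnbalancedUnicyclicComponent hN hcard (Γ.graph.connectedComponentMk (Γ.tail N e))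
    obtain ⟨u, hu, p, hp, _⟩ := hC.ge rfl
    exact h.sum_unicyclicInverse_mul_self hN hp (ConnectedComponent.eq.1 hu).symm
  · rw [h.sum_unicyclicInverse_mul_of_ne hN hef, Matrix.one_apply_ne (Ne.symm hef)]

theorem IsTU.mul_unicyclicInverse (h : Γ.IsTU) (hN : Γ.IsIncidenceMatrix N)
    (hcard : Fintype.card Γ.Edge = n) : N * Γ.unicyclicInverse N = 1 :=
  (Matrix.mul_eq_one_comm_of_card_eq _ _ _ (by rw [hcard, Fintype.card_fin])).1
    (h.unicyclicInverse_mul hN hcard)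

theorem isInt_unicyclicInverse_of_not_onCycle (hN : Γ.IsIncidenceMatrix N) {e : Γ.Edge}
    (he : ¬ Γ.OnCycle e) (a : Fin n) : ∃ m : ℤ, Γ.unicyclicInverse N e a = m := by
  have hb : ∀ x, ∃ m : ℤ, Γ.branchSign e x a = m := by
    intro x
    rw [branchSign]
    split_ifs
    · exact ⟨0, by simp⟩
    · exact isInt_pathSign _ _
  obtain ⟨w, hw⟩ := hN.isInt_weight e
  obtain ⟨p, hp⟩ := hb (Γ.tail N e)
  obtain ⟨q, hq⟩ := hb (Γ.head N e)
  refine ⟨w * (p - (Γ.sign e : ℤ) * q), ?_⟩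
  rw [unicyclicInverse_of_not_onCycle he, hw, hp, hq, rsign]
  push_cast
  rfl

theorem isInt_two_mul_unicyclicInverse (hN : Γ.IsIncidenceMatrix N) (e : Γ.Edge)
    (a : Fin n) : ∃ m : ℤ, 2 * Γ.unicyclicInverse N e a = m := by
  by_cases he : Γ.OnCycle e
  · obtain ⟨w, hw⟩ := hN.isInt_weight e
    obtain ⟨p, hp⟩ := isInt_pathSign (Γ := Γ.delete e) (Γ.tail N e) a
    refine ⟨w * p, ?_⟩
    rw [unicyclicInverse_of_onCycle he, hw, hp]
    push_cast
    ring
  · obtain ⟨m, hm⟩ := isInt_unicyclicInverse_of_not_onCycle hN he a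
    exact ⟨2 * m, by rw [hm]; push_cast; ring⟩

/-- Half-integers occur only in the row of a cycle edge. Its deletion keeps the component connected,
so the row is ±1/2 on all of it, or 0 on all of it. -/
theorem isInt_unicyclicInverse_sub (hN : Γ.IsIncidenceMatrix N) (e : Γ.Edge)
    {a b : Fin n} (hab : Γ.graph.Reachable a b) :
    ∃ m : ℤ, Γ.unicyclicInverse N e a - Γ.unicyclicInverse N e b = m := by
  by_cases he : Γ.OnCycle e
  · obtain ⟨w, hw⟩ := hN.isInt_weight e
    have hp : ∃ m : ℤ, (Γ.delete e).pathSign (Γ.tail N e) a -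
        (Γ.delete e).pathSign (Γ.tail N e) b = 2 * m := by
      have hab' := he.reachable_delete hab
      by_cases ha : (Γ.delete e).graph.Reachable (Γ.tail N e) a
      · rcases pathSign_of_reachable ha with h1 | h1 <;>
          rcases pathSign_of_reachable (ha.trans hab') with h2 | h2 <;> rw [h1, h2]
        exacts [⟨0, by norm_num⟩, ⟨1, by norm_num⟩, ⟨-1, by norm_num⟩, ⟨0, by norm_num⟩]
      · rw [pathSign_of_not_reachable ha,
          pathSign_of_not_reachable fun h => ha (h.trans hab'.symm)]
        exact ⟨0, by norm_num⟩
    obtain ⟨m, hm⟩ := hp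
    refine ⟨w * m, ?_⟩
    rw [unicyclicInverse_of_onCycle he, unicyclicInverse_of_onCycle he, hw]
    push_cast
    linear_combination (w / 2 : ℝ) * hm
  · obtain ⟨p, hp⟩ := isInt_unicyclicInverse_of_not_onCycle hN he a
    obtain ⟨q, hq⟩ := isInt_unicyclicInverse_of_not_onCycle hN he b
    exact ⟨p - q, by rw [hp, hq]; push_cast; rfl⟩

/-- Both ends of an edge are in the same class, where a positive edge contributes 0 and a negative
edge ±2. -/
theorem IsIncidenceMatrix.even_sum_class (hN : Γ.IsIncidenceMatrix N) {ρ : Fin n → Fin n}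
    (hρ : ∀ u v, Γ.graph.Reachable u v → ρ u = ρ v) (r : Fin n) (e : Γ.Edge) :
    ∃ m : ℤ, ∑ v, (if ρ v = r then N v e else 0) = 2 * m := by
  have h := hN.sum_mul (fun v => if ρ v = r then 1 else 0) e
  simp only [ite_mul, one_mul, zero_mul] at h
  obtain ⟨w, hw⟩ := hN.isInt_weight e
  rw [h, hρ _ _ (Γ.adj_tail_head N e).reachable, hw]
  split_ifs
  · rcases Γ.rsign_eq e with hs | hs <;> rw [hs]
    exacts [⟨0, by norm_num⟩, ⟨w, by ring⟩]
  · exact ⟨0, by norm_num⟩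

theorem numUnicyclic_eq (h : ∀ c, Γ.IsUnbalancedUnicyclicComponent c) :
    Γ.numUnicyclic = Nat.card Γ.graph.ConnectedComponent := by
  rw [numUnicyclic, Set.eq_univ_of_forall (s := {c | Γ.IsUnbalancedUnicyclicComponent c}) h,
    Set.ncard_univ]

end SignedGraph

/-! ### Spanning subgraphs as sets of columns -/

namespace SignedGraph

variable {n : ℕ} {Γ : SignedGraph n} {N : Matrix (Fin n) Γ.Edge ℝ}

/-- The edges of a spanning subgraph, as a set of edges of the whole graph. -/
def edgesOf (Γ : SignedGraph n) (H : Γ.SpanningSubgraph) : Set Γ.Edge :=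
  {e | e.1 ∈ H.1.edgeSet}

theorem image_edgesOf (H : Γ.SpanningSubgraph) : Subtype.val '' Γ.edgesOf H = H.1.edgeSet := by
  ext f
  exact ⟨fun ⟨e, he, hef⟩ => hef ▸ he, fun hf => ⟨⟨f, edgeSet_mono H.2 hf⟩, hf, rfl⟩⟩

theorem ncard_edgesOf (H : Γ.SpanningSubgraph) : (Γ.edgesOf H).ncard = H.1.edgeSet.ncard := by
  rw [← image_edgesOf, Set.ncard_image_of_injective _ Subtype.val_injective]

theorem edgesOf_injective {H H' : Γ.SpanningSubgraph} (h : Γ.edgesOf H = Γ.edgesOf H') :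
    H = H' :=
  Subtype.ext (edgeSet_injective (by rw [← image_edgesOf, h, image_edgesOf]))

/-- The spanning subgraph with a given set of edges. -/
def ofEdges (Γ : SignedGraph n) (S : Set Γ.Edge) : Γ.SpanningSubgraph :=
  ⟨fromEdgeSet (Subtype.val '' S), by
    intro u v h
    obtain ⟨⟨e, _, he⟩, _⟩ := (fromEdgeSet_adj _).1 h
    have := e.2
    rwa [he] at this⟩

theorem edgesOf_ofEdges (S : Set Γ.Edge) : Γ.edgesOf (Γ.ofEdges S) = S := by
  ext e
  change e.1 ∈ (fromEdgeSet (Subtype.val '' S)).edgeSet ↔ _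
  rw [edgeSet_fromEdgeSet]
  constructor
  · rintro ⟨⟨f, hf, hfe⟩, _⟩
    rwa [← Subtype.ext hfe]
  · intro he
    exact ⟨⟨e, he, rfl⟩, Γ.graph.not_isDiag_of_mem_edgeSet e.2⟩

theorem card_edge_restrict (H : Γ.SpanningSubgraph) :
    Fintype.card (Γ.restrict H).Edge = H.1.edgeSet.ncard := by
  rw [← Nat.card_eq_fintype_card]; rfl

theorem extendZero_of_mem {H : Γ.SpanningSubgraph} (X : Matrix (Γ.restrict H).Edge (Fin n) ℝ)
    {e : Γ.Edge} (h : e ∈ Γ.edgesOf H) (j : Fin n) : Γ.extendZero H X e j = X ⟨e.1, h⟩ j :=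
  dif_pos h

theorem extendZero_of_not_mem {H : Γ.SpanningSubgraph}
    (X : Matrix (Γ.restrict H).Edge (Fin n) ℝ) {e : Γ.Edge} (h : e ∉ Γ.edgesOf H) (j : Fin n) :
    Γ.extendZero H X e j = 0 :=
  dif_neg h

theorem mul_extendZero (H : Γ.SpanningSubgraph) (X : Matrix (Γ.restrict H).Edge (Fin n) ℝ) :
    N * Γ.extendZero H X = Γ.subIncidence N H * X := by
  ext i j
  rw [Matrix.mul_apply, Matrix.mul_apply]
  symm
  refine Fintype.sum_of_injective (ι := (Γ.restrict H).Edge) (Γ.edgeIncl H)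
    (fun a b hab => Subtype.ext (congrArg (fun e : Γ.Edge => e.1) hab)) _ _ (fun e he => ?_)
    fun e => ?_
  · rw [extendZero_of_not_mem, mul_zero]
    exact fun h => he ⟨⟨e.1, h⟩, rfl⟩
  · rw [extendZero_of_mem X (e := Γ.edgeIncl H e) e.2]
    rfl

theorem isPotential_restrict {z : Fin n → ℝ} (hN : Γ.IsIncidenceMatrix N)
    (H : Γ.SpanningSubgraph) :
    (Γ.restrict H).IsPotential z ↔ ∀ e ∈ Γ.edgesOf H, ∑ v, z v * N v e = 0 := by
  rw [(hN.restrict H).isPotential_iff]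
  exact ⟨fun h e he => h ⟨e.1, he⟩, fun h e => h (Γ.edgeIncl H e) e.2⟩

theorem IsPotential.restrict {z : Fin n → ℝ} (hz : Γ.IsPotential z) (H : Γ.SpanningSubgraph) :
    (Γ.restrict H).IsPotential z :=
  fun u v h => hz u v (H.2 h)

/-! ### Unbalanced case: column bases of N -/

section Unbalanced

theorem mem_spanningTU {H : Γ.SpanningSubgraph} :
    H ∈ Γ.spanningTU ↔ (Γ.restrict H).IsTU ∧ Fintype.card (Γ.restrict H).Edge = n := by
  rw [card_edge_restrict]
  simp [spanningTU]

/-- The classes in `Matrix.det_sq_of_root` are the components, with k = 2: column sums over a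
component are even, and the inverse is half-integral with constant fractional part on each
component. -/
theorem det_sq_of_mem_spanningTU (hN : Γ.IsIncidenceMatrix N) {H : Γ.SpanningSubgraph}
    (hH : H ∈ Γ.spanningTU) {g : Fin n → Γ.Edge} (hg : Function.Injective g)
    (hgH : Set.range g = Γ.edgesOf H) :
    (N.submatrix id g).det ^ 2 = 4 ^ (Γ.restrict H).numUnicyclic := by
  classical
  obtain ⟨hTU, hcard⟩ := mem_spanningTU.1 hH
  have hNH := hN.restrict H
  let X := (Γ.restrict H).unicyclicInverse (Γ.subIncidence N H)
  have hAB : N.submatrix id g * (Γ.extendZero H X).submatrix g id = 1 := by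
    rw [Matrix.submatrix_mul_submatrix_of_range
      (fun e he v => extendZero_of_not_mem X he v) hg hgH, mul_extendZero,
      hTU.mul_unicyclicInverse hNH hcard]
  let ρ : Fin n → Fin n := fun v => ((Γ.restrict H).graph.connectedComponentMk v).out
  have hmk : ∀ v, (Γ.restrict H).graph.connectedComponentMk (ρ v) =
      (Γ.restrict H).graph.connectedComponentMk v := fun v => Quot.out_eq _
  have hρr : ∀ v, (Γ.restrict H).graph.Reachable v (ρ v) := fun v =>
    ConnectedComponent.eq.1 (hmk v).symm
  have hmem : ∀ i, g i ∈ Γ.edgesOf H := fun i => hgH ▸ ⟨i, rfl⟩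
  have hX : ∀ i v, (Γ.extendZero H X).submatrix g id i v = X ⟨(g i).1, hmem i⟩ v := fun i v =>
    extendZero_of_mem X (hmem i) v
  have key := Matrix.det_sq_of_root (k := 2) hAB (fun i j => by
      rw [Matrix.submatrix_apply]
      rcases hN.apply_eq (id i) (g j) with h | h | h <;> rw [h]
      exacts [⟨0, by simp⟩, ⟨1, by simp⟩, ⟨-1, by simp⟩]) (fun _ => 1) (fun _ => Or.inl rfl) ρ
    (fun v => by simp only [ρ]; rw [hmk v])
    (fun r _ i => by
      obtain ⟨m, hm⟩ := hNH.even_sum_class (ρ := ρ) (fun u v huv => by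
        simp only [ρ]; rw [ConnectedComponent.eq.2 huv]) r ⟨(g i).1, hmem i⟩
      refine ⟨m, ?_⟩
      rw [Nat.cast_ofNat, ← hm]
      refine Finset.sum_congr rfl fun v _ => ?_
      rw [one_mul]; rfl)
    (fun i w => by
      rw [hX, hX, mul_one, mul_one]
      exact isInt_unicyclicInverse_sub hNH _ (hρr w))
    (fun i w => by
      rw [hX, Nat.cast_ofNat]
      exact isInt_two_mul_unicyclicInverse hNH _ w)
  rw [key, numUnicyclic_eq (hTU.isUnbalancedUnicyclicComponent hNH hcard)]
  have hroots : (Finset.univ.filter fun v => ρ v = v) =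
      Finset.univ.image fun c : (Γ.restrict H).graph.ConnectedComponent => c.out := by
    ext v
    simp only [Finset.mem_filter, Finset.mem_univ, true_and, Finset.mem_image]
    constructor
    · exact fun h => ⟨_, h⟩
    · rintro ⟨c, rfl⟩
      simp only [ρ]
      congr 1
      exact Quot.out_eq c
  rw [hroots, Finset.card_image_of_injective, Finset.card_univ, Nat.card_eq_fintype_card]
  · norm_num
  · intro c c' h
    rw [← Quot.out_eq c, ← Quot.out_eq c']
    exact congrArg _ h

theorem exists_spanningTU_of_det_ne_zero (hN : Γ.IsIncidenceMatrix N) {g : Fin n → Γ.Edge}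
    (hg : Function.Injective g) (hdet : (N.submatrix id g).det ≠ 0) :
    ∃ H ∈ Γ.spanningTU, Set.range g = Γ.edgesOf H := by
  let H := Γ.ofEdges (Set.range g)
  have hH : Γ.edgesOf H = Set.range g := edgesOf_ofEdges _
  have hcard : Fintype.card (Γ.restrict H).Edge = n := by
    rw [card_edge_restrict, ← ncard_edgesOf, hH, ← Set.image_univ,
      Set.ncard_image_of_injective _ hg, Set.ncard_univ, Nat.card_fin]
  refine ⟨H, mem_spanningTU.2 ⟨fun c => Or.inr ?_, hcard⟩, hH.symm⟩
  refine isUnbalancedUnicyclicComponent_of_isPotential_eq_zero (hN.restrict H) hcard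
    (fun z hz => ?_) c
  refine Matrix.eq_zero_of_vecMul_eq_zero hdet (funext fun i => ?_)
  exact (isPotential_restrict hN H).1 hz (g i) (by rw [hH]; exact ⟨i, rfl⟩)

/-- An odd cycle in a connected graph kills every potential, so `N` has full row rank and some
maximal minor is nonzero. -/
theorem spanningTU_nonempty (hN : Γ.IsIncidenceMatrix N) (hΓ : Γ.graph.Connected)
    (hu : ¬ Γ.IsBalanced) : Γ.spanningTU.Nonempty := by
  unfold IsBalanced at hu
  push Not at hu
  obtain ⟨u, p, _, hp⟩ := hu
  obtain ⟨g, hg, hdet⟩ := Matrix.exists_submatrix_det_ne_zero N fun z hz => by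
    have hz' : Γ.IsPotential z := hN.isPotential_iff.2 fun e => congrFun hz e
    exact funext fun a => hz'.eq_zero_of_odd hp (hΓ.preconnected u a)
  obtain ⟨H, hH, _⟩ := exists_spanningTU_of_det_ne_zero hN hg hdet
  exact ⟨H, hH⟩

end Unbalanced

/-! ### Balanced case: column bases of N augmented by s -/

section Balanced

theorem mem_spanningTrees {T : Γ.SpanningSubgraph} :
    T ∈ Γ.spanningTrees ↔ (Γ.restrict T).graph.IsTree := by
  simp [spanningTrees, SignedGraph.restrict]

/-- The matrix `N` with an additional column `s`. -/
def augmentCol (N : Matrix (Fin n) Γ.Edge ℝ) (s : Fin n → ℝ) :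
    Matrix (Fin n) (Option Γ.Edge) ℝ :=
  Matrix.of fun v o => o.elim (s v) (N v)

/-- The matrix `X` with an additional row `s / n`. -/
noncomputable def augmentRow (X : Matrix Γ.Edge (Fin n) ℝ) (s : Fin n → ℝ) :
    Matrix (Option Γ.Edge) (Fin n) ℝ :=
  Matrix.of fun o v => o.elim (s v / n) fun e => X e v

theorem augmentCol_mul_augmentRow (N : Matrix (Fin n) Γ.Edge ℝ) (X : Matrix Γ.Edge (Fin n) ℝ)
    (s : Fin n → ℝ) :
    augmentCol N s * augmentRow X s = (1 / (n : ℝ)) • Matrix.vecMulVec s s + N * X := by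
  ext i j
  rw [Matrix.mul_apply, Fintype.sum_option, Matrix.add_apply, Matrix.mul_apply,
    Matrix.smul_apply, Matrix.vecMulVec_apply, smul_eq_mul]
  simp only [augmentCol, augmentRow, Matrix.of_apply, Option.elim]
  ring

theorem sum_mul_self_of_sign {s : Fin n → ℝ} (hs : ∀ v, s v = 1 ∨ s v = -1) :
    ∑ v, s v * s v = n := by
  rw [Finset.sum_congr rfl fun v _ =>
    show s v * s v = 1 by rcases hs v with h | h <;> rw [h] <;> norm_num]
  simp

theorem treeInverse_mul (hn : n ≠ 0) (h : Γ.graph.IsTree) (hN : Γ.IsIncidenceMatrix N) :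
    Γ.treeInverse N * N = 1 := by
  ext e f
  rw [Matrix.mul_apply]
  by_cases hef : f = e
  · rw [hef, Matrix.one_apply_eq, sum_treeInverse_mul_self hn h hN]
  · rw [sum_treeInverse_mul_of_ne h hN hef, Matrix.one_apply_ne (Ne.symm hef)]

/-- In the opposite order, the product consists of pairings that are already known. A tree has n - 1
edges, so the augmented matrices are square and the order may be reversed. -/
theorem augmentCol_mul_augmentRow_treeInverse (hn : n ≠ 0) (h : Γ.graph.IsTree)
    (hN : Γ.IsIncidenceMatrix N) {s : Fin n → ℝ} (hs : Γ.IsPotential s)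
    (hs1 : ∀ v, s v = 1 ∨ s v = -1) :
    augmentCol N s * augmentRow (Γ.treeInverse N) s = 1 := by
  have hn' : (n : ℝ) ≠ 0 := Nat.cast_ne_zero.2 hn
  have hcard : Fintype.card (Option Γ.Edge) = Fintype.card (Fin n) := by
    have := (isTree_iff_connected_and_card.1 h).2
    rw [Fintype.card_option, ← Nat.card_eq_fintype_card, ← Nat.card_eq_fintype_card]
    exact this
  rw [Matrix.mul_eq_one_comm_of_card_eq _ _ _ hcard.symm]
  ext o o'
  rw [Matrix.mul_apply]
  cases o with
  | none =>
    cases o' with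
    | none =>
      rw [Matrix.one_apply_eq]
      simp only [augmentCol, augmentRow, Matrix.of_apply, Option.elim]
      simp_rw [div_mul_eq_mul_div]
      rw [← Finset.sum_div, sum_mul_self_of_sign hs1, div_self hn']
    | some f =>
      rw [Matrix.one_apply_ne (by simp)]
      simp only [augmentCol, augmentRow, Matrix.of_apply, Option.elim]
      simp_rw [div_mul_eq_mul_div]
      rw [← Finset.sum_div, hN.isPotential_iff.1 hs f, zero_div]
  | some e =>
    cases o' with
    | none =>
      rw [Matrix.one_apply_ne (by simp)]
      exact sum_treeInverse_mul_potential h e hs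
    | some f =>
      have := congrFun (congrFun (treeInverse_mul hn h hN) e) f
      rw [Matrix.mul_apply, Matrix.one_apply] at this
      rw [Matrix.one_apply]
      simpa [augmentCol, augmentRow, Option.elim] using this

/-- The right side is the projection orthogonal to `s`. It does not depend on the tree, so it
survives averaging over spanning trees. -/
theorem mul_treeInverse (hn : n ≠ 0) (h : Γ.graph.IsTree)
    (hN : Γ.IsIncidenceMatrix N) {s : Fin n → ℝ} (hs : Γ.IsPotential s)
    (hs1 : ∀ v, s v = 1 ∨ s v = -1) :
    N * Γ.treeInverse N = 1 - (1 / (n : ℝ)) • Matrix.vecMulVec s s := by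
  rw [← augmentCol_mul_augmentRow_treeInverse hn h hN hs hs1, augmentCol_mul_augmentRow,
    add_sub_cancel_left]

theorem transpose_one_sub_vecMulVec (s : Fin n → ℝ) :
    (1 - (1 / (n : ℝ)) • Matrix.vecMulVec s s).transpose =
      1 - (1 / (n : ℝ)) • Matrix.vecMulVec s s := by
  ext i j
  simp [Matrix.vecMulVec_apply, Matrix.one_apply, eq_comm, mul_comm]

theorem isMoorePenroseInverse_treeInverse (hn : n ≠ 0) (h : Γ.graph.IsTree)
    (hN : Γ.IsIncidenceMatrix N) {s : Fin n → ℝ} (hs : Γ.IsPotential s)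
    (hs1 : ∀ v, s v = 1 ∨ s v = -1) : IsMoorePenroseInverse N (Γ.treeInverse N) := by
  have h1 := treeInverse_mul hn h hN
  refine ⟨by rw [Matrix.mul_assoc, h1, Matrix.mul_one], by rw [h1, Matrix.one_mul], ?_,
    by rw [h1, Matrix.transpose_one]⟩
  rw [mul_treeInverse hn h hN hs hs1, transpose_one_sub_vecMulVec]

/-- The edges of a spanning subgraph and the additional column. -/
def augmentEdges (Γ : SignedGraph n) (T : Γ.SpanningSubgraph) : Set (Option Γ.Edge) :=
  insert none (some '' Γ.edgesOf T)

theorem some_mem_augmentEdges {T : Γ.SpanningSubgraph} {e : Γ.Edge} :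
    some e ∈ Γ.augmentEdges T ↔ e ∈ Γ.edgesOf T := by
  simp [augmentEdges]

theorem ncard_augmentEdges (T : Γ.SpanningSubgraph) :
    (Γ.augmentEdges T).ncard = T.1.edgeSet.ncard + 1 := by
  rw [augmentEdges, Set.ncard_insert_of_notMem (by simp),
    Set.ncard_image_of_injective _ (Option.some_injective _), ncard_edgesOf]

theorem augmentRow_eq_zero {T : Γ.SpanningSubgraph} (X : Matrix (Γ.restrict T).Edge (Fin n) ℝ)
    (s : Fin n → ℝ) : ∀ o ∉ Γ.augmentEdges T, ∀ v, augmentRow (Γ.extendZero T X) s o v = 0 := by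
  intro o ho v
  cases o with
  | none => exact (ho (Set.mem_insert _ _)).elim
  | some e => exact extendZero_of_not_mem X (fun h => ho (some_mem_augmentEdges.2 h)) v

theorem augmentCol_mul_augmentRow_extendZero (hn : n ≠ 0) (hN : Γ.IsIncidenceMatrix N)
    {s : Fin n → ℝ} (hs : Γ.IsPotential s) (hs1 : ∀ v, s v = 1 ∨ s v = -1)
    {T : Γ.SpanningSubgraph} (hT : (Γ.restrict T).graph.IsTree) :
    augmentCol N s *
      augmentRow (Γ.extendZero T ((Γ.restrict T).treeInverse (Γ.subIncidence N T))) s = 1 := by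
  rw [augmentCol_mul_augmentRow, mul_extendZero,
    mul_treeInverse hn hT (hN.restrict T) (hs.restrict T) hs1, add_sub_cancel]

/-- `Matrix.det_sq_of_root` with a single class, signs `s` and k = n: the signed sum of column `s`
is n, and that of an edge column is 0. -/
theorem det_sq_of_isTree (hn : n ≠ 0) (hN : Γ.IsIncidenceMatrix N)
    {s : Fin n → ℝ} (hs : Γ.IsPotential s) (hs1 : ∀ v, s v = 1 ∨ s v = -1)
    {T : Γ.SpanningSubgraph} (hT : (Γ.restrict T).graph.IsTree) {g : Fin n → Option Γ.Edge}
    (hg : Function.Injective g) (hgT : Set.range g = Γ.augmentEdges T) :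
    ((augmentCol N s).submatrix id g).det ^ 2 = (n : ℝ) ^ 2 := by
  have hNT := hN.restrict T
  let X := (Γ.restrict T).treeInverse (Γ.subIncidence N T)
  have hAB : (augmentCol N s).submatrix id g *
      (augmentRow (Γ.extendZero T X) s).submatrix g id = 1 := by
    rw [Matrix.submatrix_mul_submatrix_of_range (augmentRow_eq_zero X s) hg hgT,
      augmentCol_mul_augmentRow_extendZero hn hN hs hs1 hT]
  have hn' : (n : ℝ) ≠ 0 := Nat.cast_ne_zero.2 hn
  have hsi : ∀ v, ∃ m : ℤ, s v = m := fun v => by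
    rcases hs1 v with h | h <;> rw [h]
    exacts [⟨1, by simp⟩, ⟨-1, by simp⟩]
  have hss : ∀ v, s v * s v = 1 := fun v => by rcases hs1 v with h | h <;> rw [h] <;> norm_num
  have hmem : ∀ i e, g i = some e → e ∈ Γ.edgesOf T := fun i e h =>
    some_mem_augmentEdges.1 (hgT ▸ ⟨i, h⟩)
  have hrow : ∀ i e (h : g i = some e) v,
      (augmentRow (Γ.extendZero T X) s).submatrix g id i v = X ⟨e.1, hmem i e h⟩ v := by
    intro i e h v
    rw [Matrix.submatrix_apply, h]
    exact extendZero_of_mem X (hmem i e h) v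
  have hrow' : ∀ i, g i = none → ∀ v,
      (augmentRow (Γ.extendZero T X) s).submatrix g id i v = s v / n := by
    intro i h v
    rw [Matrix.submatrix_apply, h]
    rfl
  let r : Fin n := ⟨0, Nat.pos_of_ne_zero hn⟩
  have key := Matrix.det_sq_of_root (k := n) hAB (fun i j => by
      rw [Matrix.submatrix_apply]
      cases g j with
      | none => exact hsi i
      | some e =>
        change ∃ m : ℤ, N i e = m
        rcases hN.apply_eq i e with h | h | h <;> rw [h]
        exacts [⟨0, by simp⟩, ⟨1, by simp⟩, ⟨-1, by simp⟩]) s hs1 (fun _ => r) (fun _ => rfl)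
    (fun r' hr' i => by
      simp only [hr', if_true, Matrix.submatrix_apply, id_eq]
      cases g i with
      | none =>
        refine ⟨1, ?_⟩
        rw [Int.cast_one, mul_one]
        exact sum_mul_self_of_sign hs1
      | some e =>
        refine ⟨0, ?_⟩
        rw [Int.cast_zero, mul_zero]
        exact hN.isPotential_iff.1 hs e)
    (fun i w => by
      cases h : g i with
      | none =>
        rw [hrow' i h, hrow' i h, div_mul_eq_mul_div, div_mul_eq_mul_div, hss, hss, sub_self]
        exact ⟨0, by simp⟩
      | some e =>
        rw [hrow i e h, hrow i e h]
        exact treeInverse_mul_potential_sub hn hT hNT _ (hs.restrict T) hs1 w r)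
    (fun i w => by
      cases h : g i with
      | none =>
        rw [hrow' i h, mul_div_cancel₀ _ hn']
        exact hsi w
      | some e =>
        rw [hrow i e h]
        exact mul_treeInverse_isInt hn hT hNT _ w)
  rw [key]
  have : (Finset.univ.filter fun v => r = v) = {r} := by ext v; simp [eq_comm]
  rw [this, Finset.card_singleton, pow_one]

theorem exists_spanningTree_of_det_ne_zero (hn : n ≠ 0) (hN : Γ.IsIncidenceMatrix N)
    {s : Fin n → ℝ} (hs : Γ.IsPotential s) (hs1 : ∀ v, s v = 1 ∨ s v = -1)
    {g : Fin n → Option Γ.Edge} (hg : Function.Injective g)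
    (hdet : ((augmentCol N s).submatrix id g).det ≠ 0) :
    ∃ T ∈ Γ.spanningTrees, Set.range g = Γ.augmentEdges T := by
  classical
  let r : Fin n := ⟨0, Nat.pos_of_ne_zero hn⟩
  have hs0 : ∀ v, s v ≠ 0 := fun v => by rcases hs1 v with h | h <;> rw [h] <;> norm_num
  -- If the extra column were not chosen, `s` itself would be in the left kernel.
  have hnone : none ∈ Set.range g := by
    by_contra hnone
    have h0 : s = 0 := by
      refine Matrix.eq_zero_of_vecMul_eq_zero hdet (funext fun i => ?_)
      change ∑ v, s v * augmentCol N s v (g i) = 0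
      cases h : g i with
      | none => exact (hnone ⟨i, h⟩).elim
      | some e => exact hN.isPotential_iff.1 hs e
    exact hs0 r (congrFun h0 r)
  let T := Γ.ofEdges {e | some e ∈ Set.range g}
  have hT : Γ.edgesOf T = {e | some e ∈ Set.range g} := edgesOf_ofEdges _
  have hgT : Set.range g = Γ.augmentEdges T := by
    ext o
    cases o with
    | none => exact ⟨fun _ => Set.mem_insert _ _, fun _ => hnone⟩
    | some e => rw [some_mem_augmentEdges, hT]; rfl
  refine ⟨T, mem_spanningTrees.2 (isTree_iff_connected_and_card.2 ⟨?_, ?_⟩), hgT⟩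
  · have hr : ∀ a, (Γ.restrict T).graph.Reachable r a := by
      by_contra hne
      push Not at hne
      obtain ⟨a, ha⟩ := hne
      let C : Finset (Fin n) := Finset.univ.filter fun v => (Γ.restrict T).graph.Reachable r v
      -- For a disconnected T, rescaling `s` by constants on C and on its complement keeps it a
      -- potential of T; these constants make it orthogonal to `s` too, so it would be in the left
      -- kernel.
      let z : Fin n → ℝ := fun v => s v * if v ∈ C then (Cᶜ.card : ℝ) else -(C.card : ℝ)
      have hC : ∀ v, v ∈ C ↔ (Γ.restrict T).graph.Reachable r v := fun v => by simp [C]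
      have hzT : (Γ.restrict T).IsPotential z := by
        intro u v huv
        have huvC : u ∈ C ↔ v ∈ C := by
          rw [hC, hC]
          exact ⟨fun h => h.trans huv.reachable, fun h => h.trans huv.symm.reachable⟩
        change s u * _ = _ * (s v * _)
        rw [hs.restrict T u v huv, if_congr huvC rfl rfl, mul_assoc]
      have h0 : z = 0 := by
        refine Matrix.eq_zero_of_vecMul_eq_zero hdet (funext fun i => ?_)
        change ∑ v, z v * augmentCol N s v (g i) = 0
        cases h : g i with
        | none =>
          change ∑ v, z v * s v = 0
          have : ∀ v, z v * s v = if v ∈ C then (Cᶜ.card : ℝ) else -(C.card : ℝ) := by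
            intro v
            change s v * _ * s v = _
            rcases hs1 v with h | h <;> rw [h] <;> ring
          simp_rw [this]
          rw [Finset.sum_ite, Finset.sum_const, Finset.sum_const, nsmul_eq_mul, nsmul_eq_mul]
          have e1 : (Finset.univ.filter fun v => v ∈ C) = C := by ext; simp
          have e2 : (Finset.univ.filter fun v => v ∉ C) = Cᶜ := by ext; simp
          rw [e1, e2]
          ring
        | some e =>
          exact (isPotential_restrict hN T).1 hzT e (by rw [hT]; exact ⟨i, h⟩)
      have hzr := congrFun h0 r
      have hrC : r ∈ C := (hC r).2 (Reachable.refl r)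
      have haC : a ∈ Cᶜ := by rw [Finset.mem_compl, hC]; exact ha
      change s r * (if r ∈ C then _ else _) = 0 at hzr
      rw [if_pos hrC, mul_eq_zero, or_iff_right (hs0 r), Nat.cast_eq_zero,
        Finset.card_eq_zero] at hzr
      rw [hzr] at haC
      simp at haC
    have : Nonempty (Fin n) := ⟨r⟩
    exact ⟨fun a b => (hr a).symm.trans (hr b)⟩
  · change T.1.edgeSet.ncard + 1 = _
    rw [← ncard_augmentEdges, ← hgT, ← Set.image_univ, Set.ncard_image_of_injective _ hg,
      Set.ncard_univ]

end Balanced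

end SignedGraph

/-! ### The averages satisfy the Penrose equations -/

namespace SignedGraph

variable {n : ℕ} {Γ : SignedGraph n} {N : Matrix (Fin n) Γ.Edge ℝ}

theorem isMoorePenroseInverse_of_balanced (hn : n ≠ 0) (hΓ : Γ.graph.Connected)
    (hN : Γ.IsIncidenceMatrix N) {s : Fin n → ℝ} (hs : Γ.IsPotential s)
    (hs1 : ∀ v, s v = 1 ∨ s v = -1) :
    IsMoorePenroseInverse N ((1 / (Γ.spanningTrees.card : ℝ)) •
      ∑ T ∈ Γ.spanningTrees,
        Γ.extendZero T ((Γ.restrict T).treeInverse (Γ.subIncidence N T))) := by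
  have hn' : (n : ℝ) ≠ 0 := Nat.cast_ne_zero.2 hn
  let D : Γ.SpanningSubgraph → Matrix Γ.Edge (Fin n) ℝ := fun T =>
    Γ.extendZero T ((Γ.restrict T).treeInverse (Γ.subIncidence N T))
  change IsMoorePenroseInverse N ((1 / (Γ.spanningTrees.card : ℝ)) • ∑ T ∈ Γ.spanningTrees, D T)
  obtain ⟨X, hX⟩ : ∃ X, X = (1 / (Γ.spanningTrees.card : ℝ)) • ∑ T ∈ Γ.spanningTrees, D T :=
    ⟨_, rfl⟩
  have hτ : (Γ.spanningTrees.card : ℝ) ≠ 0 := by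
    obtain ⟨T, hT, hT'⟩ := hΓ.exists_isTree_le
    exact Nat.cast_ne_zero.2 (Finset.card_ne_zero_of_mem
      (mem_spanningTrees.2 hT' : (⟨T, hT⟩ : Γ.SpanningSubgraph) ∈ _))
  have hND : ∀ T ∈ Γ.spanningTrees, N * D T = 1 - (1 / (n : ℝ)) • Matrix.vecMulVec s s :=
    fun T hT => (mul_extendZero T _).trans
      (mul_treeInverse hn (mem_spanningTrees.1 hT) (hN.restrict T) (hs.restrict T) hs1)
  have hNX : N * X = 1 - (1 / (n : ℝ)) • Matrix.vecMulVec s s := by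
    rw [hX, Matrix.mul_smul, Matrix.mul_sum, Finset.sum_congr rfl hND, Finset.sum_const,
      ← Nat.cast_smul_eq_nsmul ℝ, smul_smul, one_div_mul_cancel hτ, one_smul]
  have hDs : ∀ T ∈ Γ.spanningTrees, Matrix.mulVec (D T) s = 0 := by
    intro T hT
    ext e
    change ∑ v, D T e v * s v = 0
    by_cases he : e ∈ Γ.edgesOf T
    · refine (Finset.sum_congr rfl fun v _ => ?_).trans
        (sum_treeInverse_mul_potential (N := Γ.subIncidence N T) (mem_spanningTrees.1 hT)
          ⟨e.1, he⟩ (hs.restrict T))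
      exact congrArg (· * s v) (extendZero_of_mem _ he v)
    · refine Finset.sum_eq_zero fun v _ => ?_
      exact (congrArg (· * s v) (extendZero_of_not_mem _ he v)).trans (zero_mul _)
  have hXs : Matrix.mulVec X s = 0 := by
    rw [hX, Matrix.smul_mulVec, Matrix.sum_mulVec, Finset.sum_eq_zero hDs, smul_zero]
  have hsN : Matrix.vecMul s N = 0 := funext fun e => hN.isPotential_iff.1 hs e
  rw [← hX]
  refine ⟨?_, ?_, ?_, ?_⟩
  · rw [hNX, Matrix.sub_mul, Matrix.one_mul, Matrix.smul_mul, Matrix.vecMulVec_mul, hsN]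
    ext i j
    simp [Matrix.vecMulVec_apply]
  · rw [Matrix.mul_assoc, hNX, Matrix.mul_sub, Matrix.mul_one, Matrix.mul_smul,
      Matrix.mul_vecMulVec, hXs]
    ext i j
    simp
  · rw [hNX, transpose_one_sub_vecMulVec]
  -- The exchange argument is applied to the augmented matrix; the block of its product indexed by
  -- edges is a nonzero multiple of XN, because the extra row and column do not enter there.
  · have h := Matrix.isSymm_sum_smul_mul (augmentCol N s) Γ.spanningTrees Γ.augmentEdges
      (fun T _ T' _ h => edgesOf_injective (Set.ext fun e => by
        rw [← some_mem_augmentEdges, h, some_mem_augmentEdges]))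
      (fun T => augmentRow (D T) s) (fun _ => (n : ℝ) ^ 2)
      (fun T hT => by
        rw [ncard_augmentEdges, ← Nat.card_eq_fintype_card]
        exact (isTree_iff_connected_and_card.1 (mem_spanningTrees.1 hT)).2)
      (fun T hT => augmentCol_mul_augmentRow_extendZero hn hN hs hs1 (mem_spanningTrees.1 hT))
      (fun T _ => augmentRow_eq_zero _ s)
      (fun T hT g hg hgT => det_sq_of_isTree hn hN hs hs1 (mem_spanningTrees.1 hT) hg hgT)
      (fun g hg hdet => exists_spanningTree_of_det_ne_zero hn hN hs hs1 hg hdet)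
    have hentry : ∀ e f : Γ.Edge, ((∑ T ∈ Γ.spanningTrees, (n : ℝ) ^ 2 • augmentRow (D T) s) *
        augmentCol N s) (some e) (some f) =
        (n : ℝ) ^ 2 * (Γ.spanningTrees.card : ℝ) * (X * N) e f := by
      intro e f
      have h1 : ∀ v, X e v = (1 / (Γ.spanningTrees.card : ℝ)) *
          ∑ T ∈ Γ.spanningTrees, D T e v := fun v => by
        rw [hX, Matrix.smul_apply, Matrix.sum_apply, smul_eq_mul]
      rw [Matrix.mul_apply, Matrix.mul_apply, Finset.mul_sum]
      refine Finset.sum_congr rfl fun v _ => ?_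
      rw [h1, Matrix.sum_apply]
      simp only [Matrix.smul_apply, augmentRow, augmentCol, Matrix.of_apply, Option.elim,
        smul_eq_mul, ← Finset.mul_sum]
      field_simp
    ext e f
    have h2 := congrFun (congrFun h (some e)) (some f)
    rw [Matrix.transpose_apply, hentry, hentry] at h2
    exact mul_left_cancel₀ (mul_ne_zero (pow_ne_zero 2 hn') hτ) h2

theorem isMoorePenroseInverse_of_unbalanced (hΓ : Γ.graph.Connected)
    (hN : Γ.IsIncidenceMatrix N) (hu : ¬ Γ.IsBalanced) {X : Matrix Γ.Edge (Fin n) ℝ}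
    (hX : X = (1 / ∑ H ∈ Γ.spanningTU, (4 : ℝ) ^ (Γ.restrict H).numUnicyclic) •
      ∑ H ∈ Γ.spanningTU, (4 : ℝ) ^ (Γ.restrict H).numUnicyclic •
        Γ.extendZero H ((Γ.restrict H).unicyclicInverse (Γ.subIncidence N H))) :
    IsMoorePenroseInverse N X ∧ N * X = 1 := by
  have hpos : ∑ H ∈ Γ.spanningTU, (4 : ℝ) ^ (Γ.restrict H).numUnicyclic ≠ 0 :=
    (Finset.sum_pos (fun H _ => by positivity) (spanningTU_nonempty hN hΓ hu)).ne'
  have hND : ∀ H ∈ Γ.spanningTU, N *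
      Γ.extendZero H ((Γ.restrict H).unicyclicInverse (Γ.subIncidence N H)) = 1 := by
    intro H hH
    obtain ⟨hTU, hcard⟩ := mem_spanningTU.1 hH
    rw [mul_extendZero, hTU.mul_unicyclicInverse (hN.restrict H) hcard]
  have hNX : N * X = 1 := by
    have h1 : ∀ H ∈ Γ.spanningTU, N * ((4 : ℝ) ^ (Γ.restrict H).numUnicyclic •
        Γ.extendZero H ((Γ.restrict H).unicyclicInverse (Γ.subIncidence N H))) =
        (4 : ℝ) ^ (Γ.restrict H).numUnicyclic • 1 := fun H hH => by
      rw [Matrix.mul_smul, hND H hH]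
    rw [hX, Matrix.mul_smul, Matrix.mul_sum, Finset.sum_congr rfl h1, ← Finset.sum_smul, smul_smul, one_div_mul_cancel hpos, one_smul]
  have hsymm := Matrix.isSymm_sum_smul_mul N Γ.spanningTU Γ.edgesOf
    (fun H _ H' _ h => edgesOf_injective h)
    (fun H => Γ.extendZero H ((Γ.restrict H).unicyclicInverse (Γ.subIncidence N H)))
    (fun H => (4 : ℝ) ^ (Γ.restrict H).numUnicyclic)
    (fun H hH => by
      rw [ncard_edgesOf, ← card_edge_restrict, (mem_spanningTU.1 hH).2, Fintype.card_fin])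
    hND (fun H _ e he v => extendZero_of_not_mem _ he v)
    (fun H hH g hg hgH => det_sq_of_mem_spanningTU hN hH hg hgH)
    (fun g hg hdet => exists_spanningTU_of_det_ne_zero hN hg hdet)
  refine ⟨⟨by rw [hNX, Matrix.one_mul], by rw [Matrix.mul_assoc, hNX, Matrix.mul_one],
    by rw [hNX, Matrix.transpose_one], ?_⟩, hNX⟩
  rw [hX, Matrix.smul_mul, Matrix.transpose_smul, hsymm]

end SignedGraph

theorem theorem4p1 (n : ℕ) (hn : 2 ≤ n) (Γ : SignedGraph n) (hΓ : Γ.graph.Connected)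
    (N : Matrix (Fin n) Γ.Edge ℝ) (hN : Γ.IsIncidenceMatrix N) :
    (Γ.IsBalanced →
      (∀ T ∈ Γ.spanningTrees,
        IsMoorePenroseInverse (Γ.subIncidence N T)
          ((Γ.restrict T).treeInverse (Γ.subIncidence N T))) ∧
      IsMoorePenroseInverse N
        ((1 / (Γ.spanningTrees.card : ℝ)) •
          ∑ T ∈ Γ.spanningTrees,
            Γ.extendZero T ((Γ.restrict T).treeInverse (Γ.subIncidence N T)))) ∧
    (¬ Γ.IsBalanced →
      (∀ H ∈ Γ.spanningTU,
        Γ.subIncidence N H * (Γ.restrict H).unicyclicInverse (Γ.subIncidence N H) = 1 ∧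
        (Γ.restrict H).unicyclicInverse (Γ.subIncidence N H) * Γ.subIncidence N H = 1) ∧
      ∃ X : Matrix Γ.Edge (Fin n) ℝ,
        X = (1 / ∑ H ∈ Γ.spanningTU, (4 : ℝ) ^ (Γ.restrict H).numUnicyclic) •
          ∑ H ∈ Γ.spanningTU, (4 : ℝ) ^ (Γ.restrict H).numUnicyclic •
            Γ.extendZero H ((Γ.restrict H).unicyclicInverse (Γ.subIncidence N H)) ∧
        IsMoorePenroseInverse N X ∧ N * X = 1) := by
  have hn0 : n ≠ 0 := by omega
  refine ⟨fun hb => ?_, fun hu => ⟨fun H hH => ?_, _, rfl, ?_⟩⟩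
  · let r : Fin n := ⟨0, by omega⟩
    -- The path signs from any vertex serve as the switching function s; connectedness makes all of
    -- them ±1.
    have hs : Γ.IsPotential (Γ.pathSign r) :=
      SignedGraph.isPotential_pathSign fun u _ p hp => hb u p hp
    have hs1 : ∀ v, Γ.pathSign r v = 1 ∨ Γ.pathSign r v = -1 := fun v =>
      SignedGraph.pathSign_of_reachable (hΓ.preconnected r v)
    exact ⟨fun T hT => SignedGraph.isMoorePenroseInverse_treeInverse hn0
        (SignedGraph.mem_spanningTrees.1 hT) (hN.restrict T) (hs.restrict T) hs1,
      SignedGraph.isMoorePenroseInverse_of_balanced hn0 hΓ hN hs hs1⟩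
  · obtain ⟨hTU, hcard⟩ := SignedGraph.mem_spanningTU.1 hH
    exact ⟨hTU.mul_unicyclicInverse (hN.restrict H) hcard,
      hTU.unicyclicInverse_mul (hN.restrict H) hcard⟩
  · exact SignedGraph.isMoorePenroseInverse_of_unbalanced hΓ hN hu rfl
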